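/- Let $\delta>0$, let $l:[0,\infty)\times\mathbb R^n\times\mathbb R^m\to\mathbb R$ and $f:[0,\infty)\times\mathbb R^n\times\mathbb R^m\to\mathbb R^n$ be continuous, and let $\Omega\subset\mathbb R^m$ be compact and nonempty. For $(\tau,z)\in[0,\infty)\times\mathbb R^n$ let $\mathcal D_{\tau,z}$ be the set of pairs $(x,u)$ such that $u\in L^1_{loc}([\tau,\infty);\mathbb R^m)$, $u(t)\in\Omega$ for a.e. $t\ge\tau$, $x(t)=z+\int_\tau^t f(s,x(s),u(s))\,ds$ for all $t\ge\tau$, and $t\mapsto e^{-\delta t}l(t,x(t),u(t))$ is integrable on $[\tau,\infty)$. Define the value function and the Hamiltonian by $$V(\tau,z)=\inf_{(x,u)\in\mathcal D_{\tau,z}}\int_\tau^\infty e^{-\delta t}l(t,x(t),u(t))\,dt,\qquad \mathcal H(t,x,\xi)=\inf_{u\in\Omega}\big(\langle\xi,f(t,x,u)\rangle+e^{-\delta t}l(t,x,u)\big).$$ Assume the following. 1. There is $K_1$ with $0<K_1<\delta$ such that $|l(t,x,u)-l(t,z,u)|+|f(t,x,u)-f(t,z,u)|\le K_1|x-z|$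 for all $t\ge0$, $u\in\Omega$, $x,z\in\mathbb R^n$. 2. There is $K_2>0$ such that $|l(t,x,u)|+|f(t,x,u)|\le K_2(1+|x|)$ for all $t\ge0$, $x\in\mathbb R^n$, $u\in\Omega$. 3. For all $t\ge0$, $x\in\mathbb R^n$ the set $\{(e^{-\delta t}l(t,x,v),f(t,x,v)) : v\in\Omega\}\subset\mathbb R^{1+n}$ is convex. 4. Every $(\tau,z)\in[0,\infty)\times\mathbb R^n$ has a neighborhood $N$ in $[0,\infty)\times\mathbb R^n$ and a bounded set $S\subset\mathbb R^n$ such that $x(t)\in S$ for all $t\ge\tilde\tau$, whenever $(\tilde\tau,\tilde z)\in N$ and $(x,u)\in\mathcal D_{\tilde\tau,\tilde z}$. For $\Phi:[0,\infty)\times\mathbb R^n\to\mathbb R$ let $$D^-\Phi(t,x;a,v)=\liminf_{r\downarrow0,\;w\to v}\frac{\Phi(t+ra,x+rw)-\Phi(t,x)}r,$$ and let $D^+\Phi(t,x;a,v)$ be the corresponding $\limsup$. These are extended real numbers; only $r$ with $t+ra\ge0$ are considered, and at $t=0$, for $a<0$, one sets $D^-\Phi=+\infty$ and $D^+\Phi=-\infty$.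 Let $$\partial_D\Phi(t,x)=\{(\alpha,\xi)\in\mathbb R^{1+n} : D^-\Phi(t,x;a,v)\ge a\alpha+\langle v,\xi\rangle\ \text{for all }(a,v)\in\mathbb R^{1+n}\},$$ $$\partial^D\Phi(t,x)=\{(\alpha,\xi)\in\mathbb R^{1+n} : D^+\Phi(t,x;a,v)\le a\alpha+\langle v,\xi\rangle\ \text{for all }(a,v)\in\mathbb R^{1+n}\}.$$ A continuous $\Phi:[0,\infty)\times\mathbb R^n\to\mathbb R$ such that $\Phi(\tau,z)\to0$ as $\tau\to\infty$, uniformly for $z$ in compact sets, is called a Dini sub-solution of the HJB equation $\partial_tv+\mathcal H(t,x,\partial_xv)=0$ if $\alpha+\mathcal H(t,x,\xi)\ge0$ for all $(t,x)\in[0,\infty)\times\mathbb R^n$ and $(\alpha,\xi)\in\partial^D\Phi(t,x)$; a Dini super-solution if $\alpha+\mathcal H(t,x,\xi)\le0$ for all $(t,x)\in[0,\infty)\times\mathbb R^n$ and $(\alpha,\xi)\in\partial_D\Phi(t,x)$; and a Dini solution if it is both. Then $V$ is well defined (the infimum is over a nonempty set that is bounded below). Moreover $V$ is the maximal Dini sub-solution: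 it is a Dini sub-solution, and $\Phi\le V$ on $[0,\infty)\times\mathbb R^n$ for every Dini sub-solution $\Phi$. It is also the minimal Dini super-solution: it is a Dini super-solution, and $V\le\Phi$ on $[0,\infty)\times\mathbb R^n$ for every Dini super-solution $\Phi$. Consequently $V$ is the unique Dini solution of the HJB equation. -/

import Mathlib

open Set Filter Topology MeasureTheory

noncomputable section

/-- The data of the family of discounted infinite horizon control problems: discount rate `δ`,
running cost `l`, dynamics `f` and the set `Ω` of control values. The functions `l`, `f` are only
used at times `t ≥ 0`. -/
structure ControlProblem (n m : ℕ) where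
  δ : ℝ
  l : ℝ → EuclideanSpace ℝ (Fin n) → EuclideanSpace ℝ (Fin m) → ℝ
  f : ℝ → EuclideanSpace ℝ (Fin n) → EuclideanSpace ℝ (Fin m) → EuclideanSpace ℝ (Fin n)
  Ω : Set (EuclideanSpace ℝ (Fin m))

namespace ControlProblem

variable {n m : ℕ}

/-- Admissible controls on `[τ, ∞)`: locally integrable, with values in `Ω` almost everywhere. -/
def IsControl (P : ControlProblem n m) (τ : ℝ) (u : ℝ → EuclideanSpace ℝ (Fin m)) : Prop :=
  LocallyIntegrableOn u (Ici τ) volume ∧ ∀ᵐ t ∂(volume.restrict (Ici τ)), u t ∈ P.Ω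

/-- `x` is the state trajectory on `[τ, ∞)` of the control `u`, with `x τ = z`: the integral
equation holds as an equation between genuine Lebesgue integrals, so that `x` is
locally absolutely continuous on `[τ, ∞)`. -/
def IsTrajectory (P : ControlProblem n m) (τ : ℝ) (z : EuclideanSpace ℝ (Fin n))
    (x : ℝ → EuclideanSpace ℝ (Fin n)) (u : ℝ → EuclideanSpace ℝ (Fin m)) : Prop :=
  ∀ t, τ ≤ t → IntervalIntegrable (fun s => P.f s (x s) (u s)) volume τ t ∧
    x t = z + ∫ s in τ..t, P.f s (x s) (u s)

/-- The discounted running cost `t ↦ e^{-δ t} l(t, x(t), u(t))`. -/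
def runningCost (P : ControlProblem n m) (x : ℝ → EuclideanSpace ℝ (Fin n))
    (u : ℝ → EuclideanSpace ℝ (Fin m)) (t : ℝ) : ℝ :=
  Real.exp (-P.δ * t) * P.l t (x t) (u t)

/-- The cost `J` of a process, started at time `τ`. -/
def cost (P : ControlProblem n m) (τ : ℝ) (x : ℝ → EuclideanSpace ℝ (Fin n))
    (u : ℝ → EuclideanSpace ℝ (Fin m)) : ℝ :=
  ∫ t in Ioi τ, P.runningCost x u t

/-- The admissible processes `(x, u)` with initial condition `(τ, z)` and with finite cost. -/
def processes (P : ControlProblem n m) (τ : ℝ) (z : EuclideanSpace ℝ (Fin n)) :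
    Set ((ℝ → EuclideanSpace ℝ (Fin n)) × (ℝ → EuclideanSpace ℝ (Fin m))) :=
  {p | P.IsControl τ p.2 ∧ P.IsTrajectory τ z p.1 p.2 ∧
    IntegrableOn (P.runningCost p.1 p.2) (Ioi τ) volume}

/-- The set of costs of the processes with initial condition `(τ, z)`. -/
def costs (P : ControlProblem n m) (τ : ℝ) (z : EuclideanSpace ℝ (Fin n)) : Set ℝ :=
  (fun p => P.cost τ p.1 p.2) '' P.processes τ z

/-- The value function. -/
def value (P : ControlProblem n m) (τ : ℝ) (z : EuclideanSpace ℝ (Fin n)) : ℝ :=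
  sInf (P.costs τ z)

/-- The minimized Hamiltonian `𝓗(t, x, ξ) = inf_{u ∈ Ω} (⟨ξ, f(t,x,u)⟩ + e^{-δ t} l(t,x,u))`. -/
def hamiltonian (P : ControlProblem n m) (t : ℝ) (x ξ : EuclideanSpace ℝ (Fin n)) : ℝ :=
  sInf ((fun u => inner ℝ ξ (P.f t x u) + Real.exp (-P.δ * t) * P.l t x u) '' P.Ω)

end ControlProblem

/-- The filter `r ↓ 0, w → ξ`, restricted to those `r` for which `t + r α` lies in the time domain
`[0, ∞)`. The restriction matters at `t = 0` only, where the filter is trivial if `α < 0`. -/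
def diniFilter {n : ℕ} (t α : ℝ) (ξ : EuclideanSpace ℝ (Fin n)) :
    Filter (ℝ × EuclideanSpace ℝ (Fin n)) :=
  (𝓝[>] (0 : ℝ) ×ˢ 𝓝 ξ) ⊓ 𝓟 {p | 0 ≤ t + p.1 * α}

/-- The difference quotient `(Φ(t + r α, x + r w) - Φ(t, x)) / r`, at `p = (r, w)`. -/
def diniQuotient {n : ℕ} (Φ : ℝ → EuclideanSpace ℝ (Fin n) → ℝ) (t : ℝ)
    (x : EuclideanSpace ℝ (Fin n)) (α : ℝ) (p : ℝ × EuclideanSpace ℝ (Fin n)) : EReal :=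
  (((Φ (t + p.1 * α) (x + p.1 • p.2) - Φ t x) / p.1 : ℝ) : EReal)

/-- The lower Dini derivative of `Φ` at `(t, x)` in the direction `(α, ξ)`, an extended real
number. It is `+∞` in the directions that point out of `[0, ∞) × ℝⁿ`. -/
def lowerDini {n : ℕ} (Φ : ℝ → EuclideanSpace ℝ (Fin n) → ℝ) (t : ℝ)
    (x : EuclideanSpace ℝ (Fin n)) (α : ℝ) (ξ : EuclideanSpace ℝ (Fin n)) : EReal :=
  liminf (diniQuotient Φ t x α) (diniFilter t α ξ)

/-- The upper Dini derivative of `Φ` at `(t, x)` in the direction `(α, ξ)`, an extended real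
number. It is `-∞` in the directions that point out of `[0, ∞) × ℝⁿ`. -/
def upperDini {n : ℕ} (Φ : ℝ → EuclideanSpace ℝ (Fin n) → ℝ) (t : ℝ)
    (x : EuclideanSpace ℝ (Fin n)) (α : ℝ) (ξ : EuclideanSpace ℝ (Fin n)) : EReal :=
  limsup (diniQuotient Φ t x α) (diniFilter t α ξ)

/-- The Dini sub-gradient of `Φ` at `(t, x)`. -/
def diniSubgradient {n : ℕ} (Φ : ℝ → EuclideanSpace ℝ (Fin n) → ℝ) (t : ℝ)
    (x : EuclideanSpace ℝ (Fin n)) : Set (ℝ × EuclideanSpace ℝ (Fin n)) :=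
  {p | ∀ (a : ℝ) (v : EuclideanSpace ℝ (Fin n)),
    ((a * p.1 + inner ℝ v p.2 : ℝ) : EReal) ≤ lowerDini Φ t x a v}

/-- The Dini super-gradient of `Φ` at `(t, x)`. -/
def diniSupergradient {n : ℕ} (Φ : ℝ → EuclideanSpace ℝ (Fin n) → ℝ) (t : ℝ)
    (x : EuclideanSpace ℝ (Fin n)) : Set (ℝ × EuclideanSpace ℝ (Fin n)) :=
  {p | ∀ (a : ℝ) (v : EuclideanSpace ℝ (Fin n)),
    upperDini Φ t x a v ≤ ((a * p.1 + inner ℝ v p.2 : ℝ) : EReal)}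

/-- `Φ(τ, ·) → 0` as `τ → ∞`, uniformly on every compact set. -/
def HasDecay {n : ℕ} (Φ : ℝ → EuclideanSpace ℝ (Fin n) → ℝ) : Prop :=
  ∀ K : Set (EuclideanSpace ℝ (Fin n)), IsCompact K →
    TendstoUniformlyOn Φ (fun _ => 0) atTop K

namespace ControlProblem

variable {n m : ℕ}

/-- Dini sub-solutions of the Hamilton-Jacobi-Bellman equation; only the values of `Φ` on
`[0, ∞) × ℝⁿ` matter. -/
structure IsDiniSubsolution (P : ControlProblem n m)
    (Φ : ℝ → EuclideanSpace ℝ (Fin n) → ℝ) : Prop where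
  continuousOn : ContinuousOn (fun p : ℝ × EuclideanSpace ℝ (Fin n) => Φ p.1 p.2) (Ici 0 ×ˢ univ)
  ineq : ∀ t, 0 ≤ t → ∀ x, ∀ p ∈ diniSupergradient Φ t x, 0 ≤ p.1 + P.hamiltonian t x p.2
  decay : HasDecay Φ

/-- Dini super-solutions of the Hamilton-Jacobi-Bellman equation. -/
structure IsDiniSupersolution (P : ControlProblem n m)
    (Φ : ℝ → EuclideanSpace ℝ (Fin n) → ℝ) : Prop where
  continuousOn : ContinuousOn (fun p : ℝ × EuclideanSpace ℝ (Fin n) => Φ p.1 p.2) (Ici 0 ×ˢ univ)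
  ineq : ∀ t, 0 ≤ t → ∀ x, ∀ p ∈ diniSubgradient Φ t x, p.1 + P.hamiltonian t x p.2 ≤ 0
  decay : HasDecay Φ

/-- Dini solutions of the Hamilton-Jacobi-Bellman equation. -/
def IsDiniSolution (P : ControlProblem n m) (Φ : ℝ → EuclideanSpace ℝ (Fin n) → ℝ) : Prop :=
  P.IsDiniSubsolution Φ ∧ P.IsDiniSupersolution Φ

end ControlProblem

end

/-! Dynamic programming drives everything. Along every process `V` loses at most the cost incurred
(`value_le_integral_add`), and along near-optimal processes it loses almost exactly that
(`integral_add_value_le_cost`). Differentiating the first fact along constant controls gives the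
sub-solution inequality. Differentiating the second gives the super-solution inequality, where
convexity of the extended velocity sets lets one control value reproduce the mean velocity and mean
cost (`exists_control_average`). Trajectories grow at rate at most `K₁ < δ`, so all costs converge
and `V` is continuous and decays.

Maximality: a sub-solution satisfies the first dynamic programming inequality along every process
(`subsolution_le_integral_add`). Since controls are only measurable, the trajectory is first
replaced by its Steklov average, a C¹ curve whose velocity is nearly admissible, again by convexity.
Along such a curve (`subsolution_le_along_curve`) one maximises `Φ` minus a smooth penalty around
the curve; an interior maximum would give a super-gradient violating the sub-solution inequality. As
`T → ∞`, boundedness of trajectories and decay of `Φ` remove the terminal term, leaving `Φ` below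
each cost.

Minimality: the heart is `exists_step_of_isDiniSupersolution`. From each point some short segment
with nearly admissible velocity makes `Φ` drop at nearly the rate of the cost. Otherwise a penalised
minimisation, in the spirit of the Clarke–Ledyaev mean value inequality, produces a sub-gradient at
a nearby point violating the super-solution inequality. Since `V` drops no faster than the cost, `V
- Φ` hardly decreases along the segment. A continuation argument extends this to any later time
while staying near the reachable set (`exists_nearReachable_value_sub`), without constructing an
optimal trajectory for `Φ`. At a late time both functions are small there, so `V - Φ` is at most an
arbitrarily small number at the start. -/

/-! ### Grönwall-type integral estimates -/

/-- Integral form of Grönwall's inequality. -/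
theorem le_gronwallBound_of_le_integral {φ : ℝ → ℝ} {a A K B : ℝ} (hK : 0 ≤ K)
    (hφ : ContinuousOn φ (Ici a))
    (h : ∀ t, a ≤ t → φ t ≤ A + ∫ s in a..t, (K * φ s + B)) :
    ∀ t, a ≤ t → φ t ≤ gronwallBound A K B (t - a) := by
  -- Freezing the function to the left of `a` makes it continuous on the whole line, so that its
  -- primitive is differentiable at `a` too.
  set ψ : ℝ → ℝ := fun t => φ (max a t) with hψ
  have hψc : Continuous ψ := hφ.comp_continuous (by fun_prop) (fun t => le_max_left a t)
  have hψe : ∀ t, a ≤ t → ψ t = φ t := fun t ht => by simp [hψ, max_eq_right ht]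
  have hcont : Continuous fun s => K * ψ s + B := by fun_prop
  have hG : ∀ t, HasDerivAt (fun t => A + ∫ s in a..t, (K * ψ s + B)) (K * ψ t + B) t := fun t =>
    (intervalIntegral.integral_hasDerivAt_right (hcont.intervalIntegrable _ _)
      (hcont.stronglyMeasurableAtFilter _ _) hcont.continuousAt).const_add A
  have hle : ∀ t, a ≤ t → ψ t ≤ A + ∫ s in a..t, (K * ψ s + B) := by
    intro t ht
    rw [hψe t ht]
    refine (h t ht).trans_eq ?_
    congr 1
    refine intervalIntegral.integral_congr fun s hs => ?_
    rw [uIcc_of_le ht] at hs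
    simp only [hψe s hs.1]
  intro t ht
  rw [← hψe t ht]
  refine (hle t ht).trans ?_
  -- The differential form is applied to the integral majorant, which is differentiable, and not to
  -- `φ`.
  refine le_gronwallBound_of_liminf_deriv_right_le (f' := fun t => K * ψ t + B) (b := t)
    (fun s _ => (hG s).continuousAt.continuousWithinAt) ?_ (by simp) ?_ t ⟨ht, le_rfl⟩
  · intro s _ r hr
    have := (hG s).hasDerivWithinAt (s := Ici s)
    exact this.liminf_right_slope_le hr
  · intro s hs
    have := mul_le_mul_of_nonneg_left (hle s hs.1) hK
    linarith

/-- An a.e. exponentially bounded function has an exponentially bounded primitive. -/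
theorem norm_integral_le_of_norm_le_exp {E : Type*} [NormedAddCommGroup E] [NormedSpace ℝ E]
    {g : ℝ → E} {a t C lam : ℝ} (hlam : 0 < lam) (hC : 0 ≤ C) (hat : a ≤ t)
    (h : ∀ᵐ s, s ∈ Ioc a t → ‖g s‖ ≤ C * Real.exp (lam * (s - a))) :
    ‖∫ s in a..t, g s‖ ≤ C / lam * Real.exp (lam * (t - a)) := by
  have hd : ∀ s, HasDerivAt (fun s => C / lam * Real.exp (lam * (s - a)))
      (C * Real.exp (lam * (s - a))) s := by
    intro s
    have h1 : HasDerivAt (fun s => lam * (s - a)) (lam * 1) s :=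
      ((hasDerivAt_id s).sub_const a).const_mul lam
    convert! (h1.exp.const_mul (C / lam)) using 1
    field_simp
  have hc : Continuous fun s => C * Real.exp (lam * (s - a)) := by fun_prop
  refine (intervalIntegral.norm_integral_le_of_norm_le hat h (hc.intervalIntegrable _ _)).trans ?_
  rw [intervalIntegral.integral_eq_sub_of_hasDerivAt (fun s _ => hd s) (hc.intervalIntegrable _ _)]
  have : 0 ≤ C / lam * Real.exp (lam * (a - a)) := by positivity
  linarith

/-! ### Trajectories: existence, growth and dependence on the initial state -/

namespace ControlProblem

variable {n m : ℕ}

/-- The discounted cost rate `e^{-δ t} l(t, x, u)`. -/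
noncomputable def discountedCost (P : ControlProblem n m) (t : ℝ) (x : EuclideanSpace ℝ (Fin n))
    (u : EuclideanSpace ℝ (Fin m)) : ℝ :=
  Real.exp (-P.δ * t) * P.l t x u

/-- The standing assumptions on the data of the control problem. -/
structure Standing (P : ControlProblem n m) (K₁ K₂ : ℝ) : Prop where
  δ_pos : 0 < P.δ
  Ω_nonempty : P.Ω.Nonempty
  K₁_pos : 0 < K₁
  K₂_pos : 0 < K₂
  lip : ∀ t, 0 ≤ t → ∀ u ∈ P.Ω, ∀ x z,
    |P.l t x u - P.l t z u| + ‖P.f t x u - P.f t z u‖ ≤ K₁ * ‖x - z‖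
  growth : ∀ t, 0 ≤ t → ∀ x, ∀ u ∈ P.Ω, |P.l t x u| + ‖P.f t x u‖ ≤ K₂ * (1 + ‖x‖)
  l_cont : ContinuousOn
    (fun p : ℝ × EuclideanSpace ℝ (Fin n) × EuclideanSpace ℝ (Fin m) => P.l p.1 p.2.1 p.2.2)
    (Ici 0 ×ˢ univ)
  f_cont : ContinuousOn
    (fun p : ℝ × EuclideanSpace ℝ (Fin n) × EuclideanSpace ℝ (Fin m) => P.f p.1 p.2.1 p.2.2)
    (Ici 0 ×ˢ univ)
  convex : ∀ t, 0 ≤ t → ∀ x,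
    Convex ℝ ((fun v => (P.discountedCost t x v, P.f t x v)) '' P.Ω)
  Ω_compact : IsCompact P.Ω
  K₁_lt : K₁ < P.δ

namespace Standing

variable {P : ControlProblem n m} {K₁ K₂ : ℝ} (H : P.Standing K₁ K₂)
include H

theorem norm_f_sub_le {t : ℝ} (ht : 0 ≤ t) {u} (hu : u ∈ P.Ω) (x z) :
    ‖P.f t x u - P.f t z u‖ ≤ K₁ * ‖x - z‖ :=
  (le_add_of_nonneg_left (abs_nonneg _)).trans (H.lip t ht u hu x z)

theorem exp_neg_le_one {t : ℝ} (ht : 0 ≤ t) : Real.exp (-P.δ * t) ≤ 1 := by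
  rw [Real.exp_le_one_iff]
  nlinarith [H.δ_pos]

theorem abs_l_sub_le {t : ℝ} (ht : 0 ≤ t) {u} (hu : u ∈ P.Ω) (x z) :
    |P.l t x u - P.l t z u| ≤ K₁ * ‖x - z‖ :=
  (le_add_of_nonneg_right (norm_nonneg _)).trans (H.lip t ht u hu x z)

theorem abs_discountedCost_sub_le' {t : ℝ} (ht : 0 ≤ t) {u} (hu : u ∈ P.Ω) (x z) :
    |P.discountedCost t x u - P.discountedCost t z u| ≤
      Real.exp (-P.δ * t) * (K₁ * ‖x - z‖) := by
  rw [discountedCost, discountedCost, ← mul_sub, abs_mul, abs_of_pos (Real.exp_pos _)]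
  exact mul_le_mul_of_nonneg_left (H.abs_l_sub_le ht hu x z) (Real.exp_pos _).le

theorem abs_discountedCost_sub_le {t : ℝ} (ht : 0 ≤ t) {u} (hu : u ∈ P.Ω) (x z) :
    |P.discountedCost t x u - P.discountedCost t z u| ≤ K₁ * ‖x - z‖ :=
  (H.abs_discountedCost_sub_le' ht hu x z).trans
    (mul_le_of_le_one_left (mul_nonneg H.K₁_pos.le (norm_nonneg _)) (H.exp_neg_le_one ht))

/-- Comparison with the state `0` replaces the growth rate `K₂` by the Lipschitz rate `K₁`. Only
`K₁` is known to be smaller than `δ`, so this form is what makes the discounted costs converge. -/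
theorem norm_f_le {t : ℝ} (ht : 0 ≤ t) {u} (hu : u ∈ P.Ω) (x) :
    ‖P.f t x u‖ ≤ K₁ * ‖x‖ + K₂ := by
  have h1 := H.norm_f_sub_le ht hu x 0
  have h2 := H.growth t ht 0 u hu
  have h3 := norm_sub_norm_le (P.f t x u) (P.f t 0 u)
  simp only [sub_zero, norm_zero, add_zero, mul_one] at h1 h2
  linarith [abs_nonneg (P.l t 0 u)]

theorem abs_l_le {t : ℝ} (ht : 0 ≤ t) {u} (hu : u ∈ P.Ω) (x) :
    |P.l t x u| ≤ K₁ * ‖x‖ + K₂ := by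
  have h1 := H.abs_l_sub_le ht hu x 0
  have h2 := H.growth t ht 0 u hu
  have h3 := abs_sub_abs_le_abs_sub (P.l t x u) (P.l t 0 u)
  simp only [sub_zero, norm_zero, add_zero, mul_one] at h1 h2
  linarith [norm_nonneg (P.f t 0 u)]

theorem abs_discountedCost_le' {t : ℝ} (ht : 0 ≤ t) {u} (hu : u ∈ P.Ω) (x) :
    |P.discountedCost t x u| ≤ Real.exp (-P.δ * t) * (K₁ * ‖x‖ + K₂) := by
  rw [discountedCost, abs_mul, abs_of_pos (Real.exp_pos _)]
  exact mul_le_mul_of_nonneg_left (H.abs_l_le ht hu x) (Real.exp_pos _).le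

theorem abs_discountedCost_le {t : ℝ} (ht : 0 ≤ t) {u} (hu : u ∈ P.Ω) (x) :
    |P.discountedCost t x u| ≤ K₁ * ‖x‖ + K₂ := by
  refine (H.abs_discountedCost_le' ht hu x).trans
    (mul_le_of_le_one_left ?_ (H.exp_neg_le_one ht))
  have := mul_nonneg H.K₁_pos.le (norm_nonneg x)
  linarith [H.K₂_pos]

theorem continuousOn_discountedCost : ContinuousOn
    (fun p : ℝ × EuclideanSpace ℝ (Fin n) × EuclideanSpace ℝ (Fin m) =>
      P.discountedCost p.1 p.2.1 p.2.2) (Ici 0 ×ˢ univ) :=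
  (by fun_prop : Continuous fun p : ℝ × EuclideanSpace ℝ (Fin n) × EuclideanSpace ℝ (Fin m) =>
    Real.exp (-P.δ * p.1)).continuousOn.mul H.l_cont

omit H in
/-- Composition of a function continuous on `[0, ∞) × ℝⁿ × ℝᵐ` with a state and a control. -/
theorem _root_.ContinuousOn.aestronglyMeasurable_comp_state_control
    {F : Type*} [NormedAddCommGroup F]
    {g : ℝ → EuclideanSpace ℝ (Fin n) → EuclideanSpace ℝ (Fin m) → F}
    (hg : ContinuousOn (fun p : ℝ × EuclideanSpace ℝ (Fin n) × EuclideanSpace ℝ (Fin m) =>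
      g p.1 p.2.1 p.2.2) (Ici 0 ×ˢ univ)) {τ : ℝ} (hτ : 0 ≤ τ)
    {x : ℝ → EuclideanSpace ℝ (Fin n)} (hx : ContinuousOn x (Ici τ))
    {u : ℝ → EuclideanSpace ℝ (Fin m)} (hu : AEStronglyMeasurable u (volume.restrict (Ici τ))) :
    AEStronglyMeasurable (fun s => g s (x s) (u s)) (volume.restrict (Ici τ)) := by
  -- Truncating time at `0` extends the data to a globally continuous function, which can be
  -- composed with a measurable one.
  have hc : Continuous fun p : ℝ × EuclideanSpace ℝ (Fin n) × EuclideanSpace ℝ (Fin m) =>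
      g (max p.1 0) p.2.1 p.2.2 :=
    hg.comp_continuous (f := fun p : ℝ × EuclideanSpace ℝ (Fin n) × EuclideanSpace ℝ (Fin m) =>
      (max p.1 0, p.2)) (by fun_prop) (fun p => ⟨mem_Ici.2 (le_max_right _ _), mem_univ _⟩)
  have hx' : AEStronglyMeasurable x (volume.restrict (Ici τ)) :=
    hx.aestronglyMeasurable measurableSet_Ici
  have h1 : AEStronglyMeasurable (fun s : ℝ => (s, x s, u s)) (volume.restrict (Ici τ)) :=
    aestronglyMeasurable_id.prodMk (hx'.prodMk hu)
  refine (hc.comp_aestronglyMeasurable h1).congr ?_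
  filter_upwards [ae_restrict_mem measurableSet_Ici] with s hs
  have : (0 : ℝ) ≤ s := hτ.trans hs
  simp [max_eq_left this]

omit H in
/-- A measurable function dominated by a continuous one on `[τ, ∞)` is locally integrable. -/
theorem _root_.MeasureTheory.AEStronglyMeasurable.intervalIntegrable_of_le_continuousOn
    {F : Type*} [NormedAddCommGroup F] {g : ℝ → F} {B : ℝ → ℝ} {τ : ℝ}
    (hg : AEStronglyMeasurable g (volume.restrict (Ici τ))) (hB : ContinuousOn B (Ici τ))
    (h : ∀ᵐ s ∂(volume.restrict (Ici τ)), ‖g s‖ ≤ B s) {a b : ℝ} (ha : τ ≤ a) (hb : τ ≤ b) :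
    IntervalIntegrable g volume a b := by
  have hsub : uIcc a b ⊆ Ici τ := fun s hs => (le_min ha hb).trans hs.1
  have hBi : IntervalIntegrable B volume a b := (hB.mono hsub).intervalIntegrable
  have hs' : uIoc a b ⊆ Ici τ := uIoc_subset_uIcc.trans hsub
  refine hBi.mono_fun (hg.mono_measure (Measure.restrict_mono hs' le_rfl)) ?_
  filter_upwards [ae_mono (Measure.restrict_mono hs' le_rfl) h] with s hs
  exact hs.trans (le_abs_self _)

theorem aestronglyMeasurable_f {τ : ℝ} (hτ : 0 ≤ τ) {x : ℝ → EuclideanSpace ℝ (Fin n)}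
    (hx : ContinuousOn x (Ici τ)) {u : ℝ → EuclideanSpace ℝ (Fin m)} (hu : P.IsControl τ u) :
    AEStronglyMeasurable (fun s => P.f s (x s) (u s)) (volume.restrict (Ici τ)) :=
  H.f_cont.aestronglyMeasurable_comp_state_control hτ hx hu.1.aestronglyMeasurable

theorem aestronglyMeasurable_runningCost {τ : ℝ} (hτ : 0 ≤ τ)
    {x : ℝ → EuclideanSpace ℝ (Fin n)}
    (hx : ContinuousOn x (Ici τ)) {u : ℝ → EuclideanSpace ℝ (Fin m)} (hu : P.IsControl τ u) :
    AEStronglyMeasurable (P.runningCost x u) (volume.restrict (Ici τ)) :=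
  H.continuousOn_discountedCost.aestronglyMeasurable_comp_state_control hτ hx
    hu.1.aestronglyMeasurable

theorem intervalIntegrable_f {τ : ℝ} (hτ : 0 ≤ τ) {x : ℝ → EuclideanSpace ℝ (Fin n)}
    (hx : ContinuousOn x (Ici τ)) {u : ℝ → EuclideanSpace ℝ (Fin m)} (hu : P.IsControl τ u)
    {a b : ℝ} (ha : τ ≤ a) (hb : τ ≤ b) :
    IntervalIntegrable (fun s => P.f s (x s) (u s)) volume a b := by
  refine (H.aestronglyMeasurable_f hτ hx hu).intervalIntegrable_of_le_continuousOn
    (B := fun s => K₁ * ‖x s‖ + K₂) (by fun_prop) ?_ ha hb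
  filter_upwards [hu.2, ae_restrict_mem measurableSet_Ici] with s hs hs'
  exact H.norm_f_le (hτ.trans hs') hs _

theorem intervalIntegrable_runningCost {τ : ℝ} (hτ : 0 ≤ τ) {x : ℝ → EuclideanSpace ℝ (Fin n)}
    (hx : ContinuousOn x (Ici τ)) {u : ℝ → EuclideanSpace ℝ (Fin m)} (hu : P.IsControl τ u)
    {a b : ℝ} (ha : τ ≤ a) (hb : τ ≤ b) :
    IntervalIntegrable (P.runningCost x u) volume a b := by
  refine (H.aestronglyMeasurable_runningCost hτ hx hu).intervalIntegrable_of_le_continuousOn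
    (B := fun s => K₁ * ‖x s‖ + K₂) (by fun_prop) ?_ ha hb
  filter_upwards [hu.2, ae_restrict_mem measurableSet_Ici] with s hs hs'
  exact H.abs_discountedCost_le (hτ.trans hs') hs _

omit H in
theorem _root_.ControlProblem.IsControl.ae_mem {τ : ℝ} {u : ℝ → EuclideanSpace ℝ (Fin m)}
    (hu : P.IsControl τ u) : ∀ᵐ s, τ ≤ s → u s ∈ P.Ω :=
  (ae_restrict_iff' measurableSet_Ici).1 hu.2

/-- Every control has a trajectory from every initial state (Picard iteration in a weighted
supremum norm). -/
theorem exists_isTrajectory {τ : ℝ} (hτ : 0 ≤ τ) (z : EuclideanSpace ℝ (Fin n))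
    {u : ℝ → EuclideanSpace ℝ (Fin m)} (hu : P.IsControl τ u) :
    ∃ x, ContinuousOn x (Ici τ) ∧ P.IsTrajectory τ z x u := by
  have hK := H.K₁_pos
  -- The exponential weight makes the Picard map a contraction with factor `K₁ / lam = 1 / 2` on the
  -- whole half-line. The unknown `y` is the trajectory divided by this weight.
  set lam := 2 * K₁ with hlam_def
  have hlam : 0 < lam := by positivity
  let X : BoundedContinuousFunction ℝ (EuclideanSpace ℝ (Fin n)) → ℝ →
    EuclideanSpace ℝ (Fin n) := fun y s => Real.exp (lam * (s - τ)) • y s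
  have hX : ∀ y, ContinuousOn (X y) (Ici τ) := fun y => by
    have := y.continuous
    simp only [X]; fun_prop
  let I : BoundedContinuousFunction ℝ (EuclideanSpace ℝ (Fin n)) → ℝ →
    EuclideanSpace ℝ (Fin n) := fun y t => ∫ s in τ..t, P.f s (X y s) (u s)
  have hIc : ∀ y, Continuous fun t => I y (max τ t) := by
    intro y
    refine ContinuousOn.comp_continuous (s := Ici τ) (f := fun t => max τ t) (g := I y) ?_
      (by fun_prop) (fun t => le_max_left τ t)
    intro t ht
    have h1 : ContinuousOn (I y) (uIcc τ (t + 1)) :=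
      intervalIntegral.continuousOn_primitive_interval'
        (H.intervalIntegrable_f hτ (hX y) hu le_rfl (by linarith [show τ ≤ t from ht]))
        left_mem_uIcc
    have ht' : τ ≤ t := ht
    rw [uIcc_of_le (by linarith)] at h1
    refine (h1 t ⟨ht, by linarith⟩).mono_of_mem_nhdsWithin ?_
    have : Ici τ ∩ Iio (t + 1) ∈ 𝓝[Ici τ] t :=
      inter_mem_nhdsWithin _ (Iio_mem_nhds (by linarith))
    exact mem_of_superset this fun s hs => ⟨hs.1, hs.2.le⟩
  -- Using `max τ t` keeps the image constant before `τ`, hence a bounded continuous function on all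
  -- of `ℝ`.
  let G : BoundedContinuousFunction ℝ (EuclideanSpace ℝ (Fin n)) → ℝ →
    EuclideanSpace ℝ (Fin n) := fun y t =>
      Real.exp (-(lam * (max τ t - τ))) • (z + I y (max τ t))
  have hGc : ∀ y, Continuous (G y) := fun y =>
    (by fun_prop : Continuous fun t => Real.exp (-(lam * (max τ t - τ)))).smul
      (continuous_const.add (hIc y))
  have hIb : ∀ y t, τ ≤ t →
      ‖I y t‖ ≤ (K₁ * ‖y‖ + K₂) / lam * Real.exp (lam * (t - τ)) := by
    intro y t ht
    refine norm_integral_le_of_norm_le_exp hlam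
      (add_nonneg (mul_nonneg hK.le (norm_nonneg _)) H.K₂_pos.le) ht ?_
    filter_upwards [hu.ae_mem] with s hs hst
    refine (H.norm_f_le (hτ.trans hst.1.le) (hs hst.1.le) _).trans ?_
    have h1 : 1 ≤ Real.exp (lam * (s - τ)) :=
      Real.one_le_exp (mul_nonneg hlam.le (by linarith [hst.1]))
    simp only [X, norm_smul, Real.norm_eq_abs, abs_of_pos (Real.exp_pos _)]
    have h2 : Real.exp (lam * (s - τ)) * ‖y s‖ ≤ Real.exp (lam * (s - τ)) * ‖y‖ :=
      mul_le_mul_of_nonneg_left (y.norm_coe_le_norm s) (Real.exp_pos _).le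
    nlinarith [H.K₂_pos]
  have hGb : ∀ y t, ‖G y t‖ ≤ ‖z‖ + (K₁ * ‖y‖ + K₂) / lam := by
    intro y t
    have ht : τ ≤ max τ t := le_max_left _ _
    have h1 : Real.exp (-(lam * (max τ t - τ))) ≤ 1 := by
      rw [Real.exp_le_one_iff]; nlinarith
    have h2 := hIb y _ ht
    simp only [G, norm_smul, Real.norm_eq_abs, abs_of_pos (Real.exp_pos _)]
    calc Real.exp (-(lam * (max τ t - τ))) * ‖z + I y (max τ t)‖
        ≤ Real.exp (-(lam * (max τ t - τ))) * (‖z‖ +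
            (K₁ * ‖y‖ + K₂) / lam * Real.exp (lam * (max τ t - τ))) := by
          gcongr
          exact (norm_add_le _ _).trans (by gcongr)
      _ = Real.exp (-(lam * (max τ t - τ))) * ‖z‖ + (K₁ * ‖y‖ + K₂) / lam *
            (Real.exp (-(lam * (max τ t - τ))) * Real.exp (lam * (max τ t - τ))) := by ring
      _ ≤ _ := by
          rw [← Real.exp_add]
          simp only [neg_add_cancel, Real.exp_zero, mul_one]
          gcongr
          exact mul_le_of_le_one_left (norm_nonneg _) h1
  let Γ : BoundedContinuousFunction ℝ (EuclideanSpace ℝ (Fin n)) →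
      BoundedContinuousFunction ℝ (EuclideanSpace ℝ (Fin n)) := fun y =>
    BoundedContinuousFunction.ofNormedAddCommGroup (G y) (hGc y) _ (hGb y)
  have hΓ : ContractingWith (1 / 2) Γ := by
    refine ⟨by rw [← NNReal.coe_lt_coe]; norm_num, LipschitzWith.of_dist_le_mul fun y y' => ?_⟩
    rw [BoundedContinuousFunction.dist_le (by positivity)]
    intro t
    have ht : τ ≤ max τ t := le_max_left _ _
    have h1 : ‖I y (max τ t) - I y' (max τ t)‖ ≤
        K₁ * ‖y - y'‖ / lam * Real.exp (lam * (max τ t - τ)) := by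
      simp only [I]
      rw [← intervalIntegral.integral_sub (H.intervalIntegrable_f hτ (hX y) hu le_rfl ht)
        (H.intervalIntegrable_f hτ (hX y') hu le_rfl ht)]
      refine norm_integral_le_of_norm_le_exp hlam (mul_nonneg hK.le (norm_nonneg _)) ht ?_
      filter_upwards [hu.ae_mem] with s hs hst
      refine (H.norm_f_sub_le (hτ.trans hst.1.le) (hs hst.1.le) _ _).trans ?_
      simp only [X]
      rw [← smul_sub, norm_smul, Real.norm_eq_abs, abs_of_pos (Real.exp_pos _)]
      have h2 : ‖y s - y' s‖ ≤ ‖y - y'‖ := (y - y').norm_coe_le_norm s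
      nlinarith [mul_le_mul_of_nonneg_left h2 (mul_pos hK (Real.exp_pos (lam * (s - τ)))).le]
    change dist (G y t) (G y' t) ≤ _
    simp only [G]
    rw [dist_eq_norm, ← smul_sub, norm_smul, Real.norm_eq_abs, abs_of_pos (Real.exp_pos _),
      add_sub_add_left_eq_sub, dist_eq_norm]
    calc _ ≤ Real.exp (-(lam * (max τ t - τ))) *
          (K₁ * ‖y - y'‖ / lam * Real.exp (lam * (max τ t - τ))) := by gcongr
      _ = K₁ * ‖y - y'‖ / lam *
            (Real.exp (-(lam * (max τ t - τ))) * Real.exp (lam * (max τ t - τ))) := by ring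
      _ = ((1 / 2 : NNReal) : ℝ) * ‖y - y'‖ := by
          rw [← Real.exp_add]
          simp only [neg_add_cancel, Real.exp_zero, mul_one, hlam_def]
          push_cast
          field_simp
  obtain ⟨y, hy, -⟩ := hΓ.exists_fixedPoint 0 (edist_ne_top _ _)
  refine ⟨X y, hX y, fun t ht => ⟨H.intervalIntegrable_f hτ (hX y) hu le_rfl ht, ?_⟩⟩
  have h1 : y t = G y t := by
    conv_lhs => rw [← hy]
    rfl
  simp only [X]
  rw [h1]
  simp only [G, max_eq_right ht, smul_smul, ← Real.exp_add, add_neg_cancel, Real.exp_zero,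
    one_smul]
  rfl

omit H in
theorem _root_.ControlProblem.IsTrajectory.continuousOn {τ : ℝ} {z : EuclideanSpace ℝ (Fin n)}
    {x : ℝ → EuclideanSpace ℝ (Fin n)} {u : ℝ → EuclideanSpace ℝ (Fin m)}
    (hx : P.IsTrajectory τ z x u) : ContinuousOn x (Ici τ) := by
  intro t ht
  have ht' : τ ≤ t := ht
  have h1 : ContinuousOn (fun t => z + ∫ s in τ..t, P.f s (x s) (u s)) (uIcc τ (t + 1)) :=
    continuousOn_const.add (intervalIntegral.continuousOn_primitive_interval'
      (hx (t + 1) (by linarith)).1 left_mem_uIcc)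
  rw [uIcc_of_le (by linarith)] at h1
  have h2 : ContinuousOn x (Icc τ (t + 1)) := h1.congr fun s hs => (hx s hs.1).2
  refine (h2 t ⟨ht, by linarith⟩).mono_of_mem_nhdsWithin ?_
  have : Ici τ ∩ Iio (t + 1) ∈ 𝓝[Ici τ] t :=
    inter_mem_nhdsWithin _ (Iio_mem_nhds (by linarith))
  exact mem_of_superset this fun s hs => ⟨hs.1, hs.2.le⟩

omit H in
theorem _root_.ControlProblem.IsTrajectory.apply_self {τ : ℝ} {z : EuclideanSpace ℝ (Fin n)}
    {x : ℝ → EuclideanSpace ℝ (Fin n)} {u : ℝ → EuclideanSpace ℝ (Fin m)}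
    (hx : P.IsTrajectory τ z x u) : x τ = z := by
  simpa using (hx τ le_rfl).2

/-- Growth of trajectories. -/
theorem norm_trajectory_le {τ : ℝ} (hτ : 0 ≤ τ) {z : EuclideanSpace ℝ (Fin n)}
    {x : ℝ → EuclideanSpace ℝ (Fin n)} {u : ℝ → EuclideanSpace ℝ (Fin m)}
    (hu : P.IsControl τ u) (hx : P.IsTrajectory τ z x u) {t : ℝ} (ht : τ ≤ t) :
    ‖x t‖ ≤ (‖z‖ + K₂ / K₁) * Real.exp (K₁ * (t - τ)) := by
  have hxc := hx.continuousOn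
  have hK := H.K₁_pos
  have h := le_gronwallBound_of_le_integral (φ := fun t => ‖x t‖) (A := ‖z‖) (B := K₂) hK.le
    hxc.norm (a := τ) (fun t ht => by
      conv_lhs => rw [(hx t ht).2]
      refine (norm_add_le _ _).trans (add_le_add_right ?_ _)
      refine intervalIntegral.norm_integral_le_of_norm_le ht ?_
        (ContinuousOn.intervalIntegrable ?_)
      · filter_upwards [hu.ae_mem] with s hs hst
        exact H.norm_f_le (hτ.trans hst.1.le) (hs hst.1.le) _
      · rw [uIcc_of_le ht]
        have := hxc.mono (Icc_subset_Ici_self : Icc τ t ⊆ Ici τ)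
        fun_prop) t ht
  rw [gronwallBound_of_K_ne_0 hK.ne'] at h
  have : 0 ≤ K₂ / K₁ := div_nonneg H.K₂_pos.le hK.le
  nlinarith

/-- Continuous dependence of trajectories on the initial state. -/
theorem norm_trajectory_sub_le {τ : ℝ} (hτ : 0 ≤ τ) {z z' : EuclideanSpace ℝ (Fin n)}
    {x x' : ℝ → EuclideanSpace ℝ (Fin n)} {u : ℝ → EuclideanSpace ℝ (Fin m)}
    (hu : P.IsControl τ u) (hx : P.IsTrajectory τ z x u) (hx' : P.IsTrajectory τ z' x' u)
    {t : ℝ} (ht : τ ≤ t) :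
    ‖x t - x' t‖ ≤ ‖z - z'‖ * Real.exp (K₁ * (t - τ)) := by
  have hxc := hx.continuousOn.sub hx'.continuousOn
  have hK := H.K₁_pos
  have h := le_gronwallBound_of_le_integral (φ := fun t => ‖x t - x' t‖) (A := ‖z - z'‖)
    (B := 0) hK.le hxc.norm (a := τ) (fun t ht => by
      conv_lhs => rw [(hx t ht).2, (hx' t ht).2, add_sub_add_comm]
      refine (norm_add_le _ _).trans (add_le_add_right ?_ _)
      rw [← intervalIntegral.integral_sub (hx t ht).1 (hx' t ht).1]
      refine intervalIntegral.norm_integral_le_of_norm_le ht ?_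
        (ContinuousOn.intervalIntegrable ?_)
      · filter_upwards [hu.ae_mem] with s hs hst
        rw [add_zero]
        exact H.norm_f_sub_le (hτ.trans hst.1.le) (hs hst.1.le) _ _
      · rw [uIcc_of_le ht]
        have := (hxc.mono (Icc_subset_Ici_self : Icc τ t ⊆ Ici τ)).norm
        exact (continuousOn_const.mul this).add continuousOn_const) t ht
  rwa [gronwallBound_ε0] at h

end Standing

end ControlProblem

/-! ### Costs, the value function and dynamic programming -/

namespace ControlProblem

variable {n m : ℕ}

namespace Standing

variable {P : ControlProblem n m} {K₁ K₂ : ℝ} (H : P.Standing K₁ K₂)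
include H

/-- Since `Ω` is bounded, local integrability is automatic and only measurability needs checking;
this is used for concatenated controls. -/
theorem isControl_of_aestronglyMeasurable {τ : ℝ} {u : ℝ → EuclideanSpace ℝ (Fin m)}
    (hu : AEStronglyMeasurable u (volume.restrict (Ici τ)))
    (hΩ : ∀ᵐ t ∂(volume.restrict (Ici τ)), u t ∈ P.Ω) : P.IsControl τ u := by
  obtain ⟨R, hR⟩ := H.Ω_compact.isBounded.exists_norm_le
  refine ⟨?_, hΩ⟩
  have hc : LocallyIntegrable (fun _ : ℝ => R) (volume.restrict (Ici τ)) :=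
    locallyIntegrable_const R
  refine locallyIntegrableOn_of_locallyIntegrable_restrict (hc.mono hu ?_)
  filter_upwards [hΩ] with t ht
  exact (hR _ ht).trans (le_abs_self R)

theorem isControl_const {v : EuclideanSpace ℝ (Fin m)} (hv : v ∈ P.Ω) (τ : ℝ) :
    P.IsControl τ (fun _ => v) :=
  H.isControl_of_aestronglyMeasurable aestronglyMeasurable_const (Eventually.of_forall fun _ => hv)

/-- Growth at rate `K₁` against discounting at rate `δ` leaves decay at rate `δ - K₁ > 0`, uniformly
over the controls. -/
theorem norm_runningCost_le {τ : ℝ} (hτ : 0 ≤ τ) {z : EuclideanSpace ℝ (Fin n)}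
    {x : ℝ → EuclideanSpace ℝ (Fin n)} {u : ℝ → EuclideanSpace ℝ (Fin m)}
    (hu : P.IsControl τ u) (hx : P.IsTrajectory τ z x u) :
    ∀ᵐ t ∂(volume.restrict (Ioi τ)), ‖P.runningCost x u t‖ ≤
      (K₁ * ‖z‖ + 2 * K₂) * Real.exp (-K₁ * τ) * Real.exp (-(P.δ - K₁) * t) := by
  rw [ae_restrict_iff' measurableSet_Ioi]
  filter_upwards [hu.ae_mem] with t ht htτ
  have htτ' : τ ≤ t := le_of_lt htτ
  refine (H.abs_discountedCost_le' (hτ.trans htτ') (ht htτ') (x t)).trans ?_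
  have h1 := H.norm_trajectory_le hτ hu hx htτ'
  have hK := H.K₁_pos
  have h2 : 1 ≤ Real.exp (K₁ * (t - τ)) :=
    Real.one_le_exp (mul_nonneg hK.le (by linarith))
  -- One `K₂` comes from the Grönwall bound, the other is the constant term, absorbed because the
  -- exponential is at least `1`.
  have h3 : K₁ * ‖x t‖ + K₂ ≤ (K₁ * ‖z‖ + 2 * K₂) * Real.exp (K₁ * (t - τ)) := by
    have : K₁ * ((‖z‖ + K₂ / K₁) * Real.exp (K₁ * (t - τ))) =
      (K₁ * ‖z‖ + K₂) * Real.exp (K₁ * (t - τ)) := by field_simp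
    nlinarith [H.K₂_pos]
  calc Real.exp (-P.δ * t) * (K₁ * ‖x t‖ + K₂)
      ≤ Real.exp (-P.δ * t) * ((K₁ * ‖z‖ + 2 * K₂) * Real.exp (K₁ * (t - τ))) := by gcongr
    _ = (K₁ * ‖z‖ + 2 * K₂) * (Real.exp (-P.δ * t) * Real.exp (K₁ * (t - τ))) := by ring
    _ = _ := by
      rw [mul_assoc, ← Real.exp_add, ← Real.exp_add]
      congr 2
      ring

theorem integrableOn_runningCost {τ : ℝ} (hτ : 0 ≤ τ) {z : EuclideanSpace ℝ (Fin n)}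
    {x : ℝ → EuclideanSpace ℝ (Fin n)} {u : ℝ → EuclideanSpace ℝ (Fin m)}
    (hu : P.IsControl τ u) (hx : P.IsTrajectory τ z x u) :
    IntegrableOn (P.runningCost x u) (Ioi τ) :=
  Integrable.mono'
    ((integrableOn_exp_mul_Ioi (by linarith [H.K₁_lt] : -(P.δ - K₁) < 0) τ).const_mul _)
    ((H.aestronglyMeasurable_runningCost hτ hx.continuousOn hu).mono_measure
      (Measure.restrict_mono Ioi_subset_Ici_self le_rfl))
    (H.norm_runningCost_le hτ hu hx)

/-- The finiteness of the cost is automatic. -/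
theorem mem_processes {τ : ℝ} (hτ : 0 ≤ τ) {z : EuclideanSpace ℝ (Fin n)}
    {x : ℝ → EuclideanSpace ℝ (Fin n)} {u : ℝ → EuclideanSpace ℝ (Fin m)}
    (hu : P.IsControl τ u) (hx : P.IsTrajectory τ z x u) : (x, u) ∈ P.processes τ z :=
  ⟨hu, hx, H.integrableOn_runningCost hτ hu hx⟩

theorem exists_mem_processes {τ : ℝ} (hτ : 0 ≤ τ) (z : EuclideanSpace ℝ (Fin n))
    {u : ℝ → EuclideanSpace ℝ (Fin m)} (hu : P.IsControl τ u) :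
    ∃ x, (x, u) ∈ P.processes τ z := by
  obtain ⟨x, -, hx⟩ := H.exists_isTrajectory hτ z hu
  exact ⟨x, H.mem_processes hτ hu hx⟩

theorem exists_const_mem_processes {τ : ℝ} (hτ : 0 ≤ τ) (z : EuclideanSpace ℝ (Fin n))
    {v : EuclideanSpace ℝ (Fin m)} (hv : v ∈ P.Ω) :
    ∃ x, (x, fun _ => v) ∈ P.processes τ z :=
  H.exists_mem_processes hτ z (H.isControl_const hv τ)

/-- Integrating the pointwise bound recombines the two exponentials into `e^{-δ τ}`. Being uniform
over processes, this yields both the lower bound on the costs and the decay of the value function.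
-/
theorem abs_cost_le {τ : ℝ} (hτ : 0 ≤ τ) {z : EuclideanSpace ℝ (Fin n)}
    {x : ℝ → EuclideanSpace ℝ (Fin n)} {u : ℝ → EuclideanSpace ℝ (Fin m)}
    (h : (x, u) ∈ P.processes τ z) :
    |P.cost τ x u| ≤ (K₁ * ‖z‖ + 2 * K₂) / (P.δ - K₁) * Real.exp (-P.δ * τ) := by
  have hneg : -(P.δ - K₁) < 0 := by linarith [H.K₁_lt]
  have h1 := norm_integral_le_of_norm_le
    ((integrableOn_exp_mul_Ioi hneg τ).const_mul _) (H.norm_runningCost_le hτ h.1 h.2.1)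
  refine h1.trans_eq ?_
  rw [integral_const_mul, integral_exp_mul_Ioi hneg]
  have : Real.exp (-P.δ * τ) = Real.exp (-K₁ * τ) * Real.exp (-(P.δ - K₁) * τ) := by
    rw [← Real.exp_add]; congr 1; ring
  rw [this]
  have : P.δ - K₁ ≠ 0 := by linarith [H.K₁_lt]
  field_simp

theorem costs_nonempty {τ : ℝ} (hτ : 0 ≤ τ) (z : EuclideanSpace ℝ (Fin n)) :
    (P.costs τ z).Nonempty := by
  obtain ⟨v, hv⟩ := H.Ω_nonempty
  obtain ⟨x, hx⟩ := H.exists_const_mem_processes hτ z hv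
  exact ⟨_, _, hx, rfl⟩

theorem costs_bddBelow {τ : ℝ} (hτ : 0 ≤ τ) (z : EuclideanSpace ℝ (Fin n)) :
    BddBelow (P.costs τ z) := by
  refine ⟨-((K₁ * ‖z‖ + 2 * K₂) / (P.δ - K₁) * Real.exp (-P.δ * τ)), ?_⟩
  rintro _ ⟨⟨x, u⟩, hp, rfl⟩
  exact (abs_le.1 (H.abs_cost_le hτ hp)).1

theorem isGLB_value {τ : ℝ} (hτ : 0 ≤ τ) (z : EuclideanSpace ℝ (Fin n)) :
    IsGLB (P.costs τ z) (P.value τ z) :=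
  isGLB_csInf (H.costs_nonempty hτ z) (H.costs_bddBelow hτ z)

theorem value_le_cost {τ : ℝ} (hτ : 0 ≤ τ) {z : EuclideanSpace ℝ (Fin n)}
    {x : ℝ → EuclideanSpace ℝ (Fin n)} {u : ℝ → EuclideanSpace ℝ (Fin m)}
    (h : (x, u) ∈ P.processes τ z) : P.value τ z ≤ P.cost τ x u :=
  csInf_le (H.costs_bddBelow hτ z) ⟨_, h, rfl⟩

theorem le_value {τ : ℝ} (hτ : 0 ≤ τ) {z : EuclideanSpace ℝ (Fin n)} {a : ℝ}
    (h : ∀ x u, (x, u) ∈ P.processes τ z → a ≤ P.cost τ x u) : a ≤ P.value τ z := by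
  refine le_csInf (H.costs_nonempty hτ z) ?_
  rintro _ ⟨⟨x, u⟩, hp, rfl⟩
  exact h x u hp

theorem exists_cost_lt {τ : ℝ} (hτ : 0 ≤ τ) (z : EuclideanSpace ℝ (Fin n)) {ε : ℝ}
    (hε : 0 < ε) : ∃ x u, (x, u) ∈ P.processes τ z ∧ P.cost τ x u < P.value τ z + ε := by
  by_contra! hcon
  linarith [H.le_value hτ hcon]

theorem abs_value_le {τ : ℝ} (hτ : 0 ≤ τ) (z : EuclideanSpace ℝ (Fin n)) :
    |P.value τ z| ≤ (K₁ * ‖z‖ + 2 * K₂) / (P.δ - K₁) * Real.exp (-P.δ * τ) := by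
  obtain ⟨v, hv⟩ := H.Ω_nonempty
  obtain ⟨x, hx⟩ := H.exists_const_mem_processes hτ z hv
  rw [abs_le]
  exact ⟨H.le_value hτ fun x u hp => (abs_le.1 (H.abs_cost_le hτ hp)).1,
    (H.value_le_cost hτ hx).trans (abs_le.1 (H.abs_cost_le hτ hx)).2⟩

theorem hasDecay_value : HasDecay P.value := by
  intro K hK
  obtain ⟨R, hR⟩ := hK.isBounded.exists_norm_le
  rw [Metric.tendstoUniformlyOn_iff]
  intro ε hε
  have hlim : Tendsto (fun τ => (K₁ * R + 2 * K₂) / (P.δ - K₁) * Real.exp (-P.δ * τ))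
      atTop (𝓝 0) := by
    have h1 : Tendsto (fun τ => -P.δ * τ) atTop atBot :=
      tendsto_id.const_mul_atTop_of_neg (by linarith [H.δ_pos])
    simpa using (Real.tendsto_exp_atBot.comp h1).const_mul ((K₁ * R + 2 * K₂) / (P.δ - K₁))
  filter_upwards [hlim.eventually_lt_const hε, eventually_ge_atTop 0] with τ hτ hτ0 z hz
  rw [dist_zero_left, Real.norm_eq_abs]
  refine (H.abs_value_le hτ0 z).trans_lt (lt_of_le_of_lt ?_ hτ)
  have := hR z hz
  have := H.K₁_pos
  have : 0 < P.δ - K₁ := by linarith [H.K₁_lt]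
  gcongr

/-- The value function is Lipschitz in the state. -/
theorem value_sub_le {τ : ℝ} (hτ : 0 ≤ τ) (z z' : EuclideanSpace ℝ (Fin n)) :
    P.value τ z - P.value τ z' ≤ K₁ / (P.δ - K₁) * ‖z - z'‖ := by
  have hneg : -(P.δ - K₁) < 0 := by linarith [H.K₁_lt]
  have hpos : 0 < P.δ - K₁ := by linarith [H.K₁_lt]
  have hK := H.K₁_pos
  suffices P.value τ z - K₁ / (P.δ - K₁) * ‖z - z'‖ ≤ P.value τ z' by linarith
  refine H.le_value hτ fun x' u hp' => ?_
  -- The same control is run from the other initial state; the two trajectories separate at rate at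
  -- most `K₁ < δ`.
  obtain ⟨x, hp⟩ := H.exists_mem_processes hτ z hp'.1
  have h1 : P.cost τ x u - P.cost τ x' u ≤ K₁ / (P.δ - K₁) * ‖z - z'‖ := by
    rw [cost, cost, ← integral_sub hp.2.2 hp'.2.2]
    have hb : ∀ᵐ t ∂(volume.restrict (Ioi τ)), ‖P.runningCost x u t - P.runningCost x' u t‖ ≤
        K₁ * ‖z - z'‖ * Real.exp (-K₁ * τ) * Real.exp (-(P.δ - K₁) * t) := by
      rw [ae_restrict_iff' measurableSet_Ioi]
      filter_upwards [hp.1.ae_mem] with t ht htτ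
      have htτ' : τ ≤ t := le_of_lt htτ
      refine (H.abs_discountedCost_sub_le' (hτ.trans htτ') (ht htτ') (x t) (x' t)).trans ?_
      have h2 := H.norm_trajectory_sub_le hτ hp.1 hp.2.1 hp'.2.1 htτ'
      calc Real.exp (-P.δ * t) * (K₁ * ‖x t - x' t‖)
          ≤ Real.exp (-P.δ * t) * (K₁ * (‖z - z'‖ * Real.exp (K₁ * (t - τ)))) := by gcongr
        _ = K₁ * ‖z - z'‖ * (Real.exp (-P.δ * t) * Real.exp (K₁ * (t - τ))) := by ring
        _ = _ := by
          rw [mul_assoc _ (Real.exp (-K₁ * τ)), ← Real.exp_add, ← Real.exp_add]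
          congr 2
          ring
    refine (le_abs_self _).trans ((norm_integral_le_of_norm_le
      ((integrableOn_exp_mul_Ioi hneg τ).const_mul _) hb).trans ?_)
    rw [integral_const_mul, integral_exp_mul_Ioi hneg]
    have h3 : Real.exp (-K₁ * τ) * Real.exp (-(P.δ - K₁) * τ) ≤ 1 := by
      rw [← Real.exp_add, Real.exp_le_one_iff]
      nlinarith [H.δ_pos]
    calc K₁ * ‖z - z'‖ * Real.exp (-K₁ * τ) * (-Real.exp (-(P.δ - K₁) * τ) / -(P.δ - K₁))
        = K₁ / (P.δ - K₁) * ‖z - z'‖ *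
          (Real.exp (-K₁ * τ) * Real.exp (-(P.δ - K₁) * τ)) := by field_simp
      _ ≤ K₁ / (P.δ - K₁) * ‖z - z'‖ * 1 := by gcongr
      _ = _ := mul_one _
  linarith [H.value_le_cost hτ hp]

theorem abs_value_sub_le {τ : ℝ} (hτ : 0 ≤ τ) (z z' : EuclideanSpace ℝ (Fin n)) :
    |P.value τ z - P.value τ z'| ≤ K₁ / (P.δ - K₁) * ‖z - z'‖ := by
  rw [abs_le]
  refine ⟨?_, H.value_sub_le hτ z z'⟩
  have := H.value_sub_le hτ z' z
  rw [norm_sub_rev] at this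
  linarith

omit H in
theorem _root_.ControlProblem.IsControl.mono {τ s : ℝ} {u : ℝ → EuclideanSpace ℝ (Fin m)}
    (hu : P.IsControl τ u) (hs : τ ≤ s) : P.IsControl s u :=
  ⟨hu.1.mono_set (Ici_subset_Ici.2 hs),
    ae_mono (Measure.restrict_mono (Ici_subset_Ici.2 hs) le_rfl) hu.2⟩

omit H in
theorem _root_.ControlProblem.IsTrajectory.sub_eq {τ : ℝ} {z : EuclideanSpace ℝ (Fin n)}
    {x : ℝ → EuclideanSpace ℝ (Fin n)} {u : ℝ → EuclideanSpace ℝ (Fin m)}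
    (hx : P.IsTrajectory τ z x u) {s t : ℝ} (hs : τ ≤ s) (ht : τ ≤ t) :
    IntervalIntegrable (fun r => P.f r (x r) (u r)) volume s t ∧
      x t = x s + ∫ r in s..t, P.f r (x r) (u r) := by
  have h1 := hx s hs
  have h2 := hx t ht
  refine ⟨h1.1.symm.trans h2.1, ?_⟩
  rw [h2.2, ← intervalIntegral.integral_add_adjacent_intervals h1.1 (h1.1.symm.trans h2.1),
    ← add_assoc, ← h1.2]

omit H in
theorem _root_.ControlProblem.processes.restrict {τ : ℝ} {z : EuclideanSpace ℝ (Fin n)}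
    {x : ℝ → EuclideanSpace ℝ (Fin n)} {u : ℝ → EuclideanSpace ℝ (Fin m)}
    (h : (x, u) ∈ P.processes τ z) {s : ℝ} (hs : τ ≤ s) : (x, u) ∈ P.processes s (x s) :=
  ⟨h.1.mono hs, fun _ ht => h.2.1.sub_eq hs (hs.trans ht),
    h.2.2.mono_set (Ioi_subset_Ioi hs)⟩

omit H in
theorem _root_.ControlProblem.processes.cost_eq {τ : ℝ} {z : EuclideanSpace ℝ (Fin n)}
    {x : ℝ → EuclideanSpace ℝ (Fin n)} {u : ℝ → EuclideanSpace ℝ (Fin m)}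
    (h : (x, u) ∈ P.processes τ z) {s : ℝ} (hs : τ ≤ s) :
    P.cost τ x u = (∫ t in τ..s, P.runningCost x u t) + P.cost s x u :=
  (intervalIntegral.integral_interval_add_Ioi h.2.2
    (processes.restrict h hs).2.2).symm

/-- Concatenation of processes. -/
theorem concat {τ s : ℝ} (hτ : 0 ≤ τ) (hs : τ ≤ s) {z : EuclideanSpace ℝ (Fin n)}
    {x y : ℝ → EuclideanSpace ℝ (Fin n)} {u v : ℝ → EuclideanSpace ℝ (Fin m)}
    (h : (x, u) ∈ P.processes τ z) (h' : (y, v) ∈ P.processes s (x s)) :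
    ((Iic s).piecewise x y, (Iic s).piecewise u v) ∈ P.processes τ z := by
  set w := (Iic s).piecewise u v with hw
  set X := (Iic s).piecewise x y with hX
  have hwu : ∀ t ∈ Iic s, w t = u t := fun t ht => piecewise_eq_of_mem _ _ _ ht
  have hXx : ∀ t ∈ Iic s, X t = x t := fun t ht => piecewise_eq_of_mem _ _ _ ht
  have hwv : ∀ t, s < t → w t = v t := fun t ht =>
    piecewise_eq_of_notMem _ _ _ (by simpa using ht)
  have hXy : ∀ t, s < t → X t = y t := fun t ht =>
    piecewise_eq_of_notMem _ _ _ (by simpa using ht)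
  have hcontrol : P.IsControl τ w := by
    refine H.isControl_of_aestronglyMeasurable ?_ ?_
    · refine AEStronglyMeasurable.piecewise measurableSet_Iic
        (h.1.1.aestronglyMeasurable.mono_measure Measure.restrict_le_self) ?_
      refine h'.1.1.aestronglyMeasurable.mono_measure ?_
      rw [Measure.restrict_restrict measurableSet_Iic.compl]
      refine Measure.restrict_mono (fun t ht => ?_) le_rfl
      exact le_of_lt (by simpa using ht.1)
    · rw [ae_restrict_iff' measurableSet_Ici]
      filter_upwards [h.1.ae_mem, h'.1.ae_mem] with t h1 h2 ht
      rcases le_or_gt t s with hts | hts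
      · rw [hwu t hts]; exact h1 ht
      · rw [hwv t hts]; exact h2 hts.le
  refine H.mem_processes hτ hcontrol ?_
  have hleft : ∀ t, τ ≤ t → t ≤ s → EqOn (fun r => P.f r (x r) (u r))
      (fun r => P.f r (X r) (w r)) (uIoc τ t) := by
    intro t ht hts r hr
    rw [uIoc_of_le ht] at hr
    have hrs : r ∈ Iic s := hr.2.trans hts
    simp only [hwu r hrs, hXx r hrs]
  have h1 : ∀ t, τ ≤ t → t ≤ s → IntervalIntegrable (fun r => P.f r (X r) (w r)) volume τ t ∧
      X t = z + ∫ r in τ..t, P.f r (X r) (w r) := by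
    intro t ht hts
    refine ⟨(h.2.1 t ht).1.congr (hleft t ht hts), ?_⟩
    rw [hXx t hts, ← intervalIntegral.integral_congr_ae
      (Eventually.of_forall fun r hr => hleft t ht hts hr)]
    exact (h.2.1 t ht).2
  intro t ht
  rcases le_or_gt t s with hts | hts
  · exact h1 t ht hts
  · have hright : EqOn (fun r => P.f r (y r) (v r)) (fun r => P.f r (X r) (w r)) (uIoc s t) := by
      intro r hr
      rw [uIoc_of_le hts.le] at hr
      simp only [hwv r hr.1, hXy r hr.1]
    have h2 := h1 s hs le_rfl
    have h3 : IntervalIntegrable (fun r => P.f r (y r) (v r)) volume s t ∧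
      y t = x s + ∫ r in s..t, P.f r (y r) (v r) := h'.2.1 t hts.le
    have h4 := h3.1.congr hright
    refine ⟨h2.1.trans h4, ?_⟩
    rw [hXy t hts, h3.2, ← intervalIntegral.integral_add_adjacent_intervals h2.1 h4,
      ← add_assoc, ← h2.2, hXx s (mem_Iic.2 le_rfl), intervalIntegral.integral_congr_ae
        (Eventually.of_forall fun r hr => hright hr)]

/-- Dynamic programming: the value function does not decrease faster than the cost accumulates
along any process. -/
theorem value_le_integral_add {τ s : ℝ} (hτ : 0 ≤ τ) (hs : τ ≤ s)
    {z : EuclideanSpace ℝ (Fin n)}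
    {x : ℝ → EuclideanSpace ℝ (Fin n)} {u : ℝ → EuclideanSpace ℝ (Fin m)}
    (h : (x, u) ∈ P.processes τ z) :
    P.value τ z ≤ (∫ t in τ..s, P.runningCost x u t) + P.value s (x s) := by
  suffices P.value τ z - (∫ t in τ..s, P.runningCost x u t) ≤ P.value s (x s) by linarith
  refine H.le_value (hτ.trans hs) fun y v h' => ?_
  have hc := H.concat hτ hs h h'
  have h1 := H.value_le_cost hτ hc
  rw [processes.cost_eq hc hs] at h1
  have h2 : ∫ t in τ..s, P.runningCost ((Iic s).piecewise x y) ((Iic s).piecewise u v) t =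
      ∫ t in τ..s, P.runningCost x u t := by
    refine intervalIntegral.integral_congr_ae (Eventually.of_forall fun r hr => ?_)
    rw [uIoc_of_le hs] at hr
    have hr' : r ∈ Iic s := hr.2
    simp only [runningCost, piecewise_eq_of_mem _ _ _ hr']
  have h3 : P.cost s ((Iic s).piecewise x y) ((Iic s).piecewise u v) = P.cost s y v := by
    refine setIntegral_congr_fun measurableSet_Ioi fun r hr => ?_
    have hr' : r ∉ Iic s := by simpa using hr
    simp only [runningCost, piecewise_eq_of_notMem _ _ _ hr']
  linarith

/-- The tail of a process is itself a competitor at time `s`. This is the other half of dynamic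
programming, useful for near-optimal processes. -/
theorem integral_add_value_le_cost {τ s : ℝ} (hτ : 0 ≤ τ) (hs : τ ≤ s)
    {z : EuclideanSpace ℝ (Fin n)}
    {x : ℝ → EuclideanSpace ℝ (Fin n)} {u : ℝ → EuclideanSpace ℝ (Fin m)}
    (h : (x, u) ∈ P.processes τ z) :
    (∫ t in τ..s, P.runningCost x u t) + P.value s (x s) ≤ P.cost τ x u := by
  rw [processes.cost_eq h hs]
  linarith [H.value_le_cost (hτ.trans hs) (processes.restrict h hs)]

end Standing

end ControlProblem

/-! ### Test functions and Dini derivatives -/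

section Dini

variable {n : ℕ} {Φ : ℝ → EuclideanSpace ℝ (Fin n) → ℝ} {t a : ℝ}
  {x v : EuclideanSpace ℝ (Fin n)}

theorem diniFilter_le (t a : ℝ) (v : EuclideanSpace ℝ (Fin n)) :
    diniFilter t a v ≤ 𝓝[>] (0 : ℝ) ×ˢ 𝓝 v := inf_le_left

theorem tendsto_diniPath (t a : ℝ) (x v : EuclideanSpace ℝ (Fin n)) :
    Tendsto (fun p : ℝ × EuclideanSpace ℝ (Fin n) => (t + p.1 * a, x + p.1 • p.2))
      (diniFilter t a v) (𝓝 (t, x)) := by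
  have hc : Continuous fun p : ℝ × EuclideanSpace ℝ (Fin n) =>
    (t + p.1 * a, x + p.1 • p.2) := by fun_prop
  have h := hc.tendsto (0, v)
  simp only [zero_mul, add_zero, zero_smul] at h
  refine h.mono_left ((diniFilter_le t a v).trans ?_)
  rw [nhds_prod_eq]
  exact Filter.prod_mono_left _ nhdsWithin_le_nhds

theorem eventually_diniFilter_pos (t a : ℝ) (v : EuclideanSpace ℝ (Fin n)) :
    ∀ᶠ p in diniFilter t a v, 0 < p.1 ∧ 0 ≤ t + p.1 * a := by
  refine Filter.Eventually.and ?_ (mem_inf_of_right (mem_principal_self _))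
  have : ∀ᶠ r in 𝓝[>] (0 : ℝ), 0 < r := self_mem_nhdsWithin
  exact diniFilter_le t a v (this.prod_inl _)

/-- Fréchet differentiability is uniform in the direction, so `r` and `w` may vary together. When
the filter is trivial, the assertion is vacuous. -/
theorem HasFDerivAt.tendsto_diniQuotient {ψ : ℝ × EuclideanSpace ℝ (Fin n) → ℝ}
    {D : ℝ × EuclideanSpace ℝ (Fin n) →L[ℝ] ℝ} (hψ : HasFDerivAt ψ D (t, x)) (a : ℝ)
    (v : EuclideanSpace ℝ (Fin n)) :
    Tendsto (fun p : ℝ × EuclideanSpace ℝ (Fin n) =>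
      (ψ (t + p.1 * a, x + p.1 • p.2) - ψ (t, x)) / p.1) (diniFilter t a v) (𝓝 (D (a, v))) := by
  have hfst : Tendsto (fun p : ℝ × EuclideanSpace ℝ (Fin n) => p.1) (diniFilter t a v)
      (𝓝[>] 0) := tendsto_fst.mono_left (diniFilter_le t a v)
  have hsnd : Tendsto (fun p : ℝ × EuclideanSpace ℝ (Fin n) => p.2) (diniFilter t a v)
      (𝓝 v) := tendsto_snd.mono_left (diniFilter_le t a v)
  have h := (hψ.hasFDerivWithinAt (s := univ)).lim (l := diniFilter t a v)
    (c := fun p => p.1⁻¹) (d := fun p => (p.1 * a, p.1 • p.2)) (v := (a, v))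
    ?_ (Eventually.of_forall fun _ => mem_univ _) ?_
  · refine h.congr fun p => ?_
    simp only [Prod.mk_add_mk, smul_eq_mul]
    rw [div_eq_inv_mul]
  · have h3 := hfst.mono_right nhdsWithin_le_nhds
    have h4 := (h3.mul_const a).prodMk_nhds (h3.smul hsnd)
    rwa [zero_mul, zero_smul] at h4
  · have h2 : Tendsto (fun p : ℝ × EuclideanSpace ℝ (Fin n) => (a, p.2)) (diniFilter t a v)
      (𝓝 (a, v)) := tendsto_const_nhds.prodMk_nhds hsnd
    refine h2.congr' ?_
    filter_upwards [eventually_diniFilter_pos t a v] with p hp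
    simp only [Prod.smul_mk, smul_smul, smul_eq_mul]
    rw [inv_mul_cancel_left₀ hp.1.ne', inv_mul_cancel₀ hp.1.ne', one_smul]

/-- A smooth function touching `Φ` from above at `(t, x)` yields a super-gradient. -/
theorem mem_diniSupergradient_of_hasFDerivAt {ψ : ℝ × EuclideanSpace ℝ (Fin n) → ℝ}
    {D : ℝ × EuclideanSpace ℝ (Fin n) →L[ℝ] ℝ} (hψ : HasFDerivAt ψ D (t, x))
    (hle : ∀ᶠ q in 𝓝 (t, x), 0 ≤ q.1 → Φ q.1 q.2 - Φ t x ≤ ψ q - ψ (t, x))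
    {α : ℝ} {ξ : EuclideanSpace ℝ (Fin n)} (hD : ∀ a v, D (a, v) = a * α + inner ℝ v ξ) :
    (α, ξ) ∈ diniSupergradient Φ t x := by
  intro a v
  refine le_of_forall_gt_imp_ge_of_dense fun c hc => ?_
  have h1 := hψ.tendsto_diniQuotient a v
  rw [hD] at h1
  have h2 : Tendsto (fun p : ℝ × EuclideanSpace ℝ (Fin n) =>
      (((ψ (t + p.1 * a, x + p.1 • p.2) - ψ (t, x)) / p.1 : ℝ) : EReal)) (diniFilter t a v)
      (𝓝 ((a * α + inner ℝ v ξ : ℝ) : EReal)) :=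
    (continuous_coe_real_ereal.tendsto _).comp h1
  refine limsup_le_of_le (by isBoundedDefault) ?_
  filter_upwards [h2.eventually_lt_const hc, (tendsto_diniPath t a x v).eventually hle,
    eventually_diniFilter_pos t a v] with p hp1 hp2 hp3
  refine le_trans ?_ hp1.le
  rw [diniQuotient, EReal.coe_le_coe_iff]
  exact div_le_div_of_nonneg_right (hp2 hp3.2) hp3.1.le

/-- A smooth function touching `Φ` from below at `(t, x)` yields a sub-gradient. -/
theorem mem_diniSubgradient_of_hasFDerivAt {ψ : ℝ × EuclideanSpace ℝ (Fin n) → ℝ}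
    {D : ℝ × EuclideanSpace ℝ (Fin n) →L[ℝ] ℝ} (hψ : HasFDerivAt ψ D (t, x))
    (hle : ∀ᶠ q in 𝓝 (t, x), 0 ≤ q.1 → ψ q - ψ (t, x) ≤ Φ q.1 q.2 - Φ t x)
    {α : ℝ} {ξ : EuclideanSpace ℝ (Fin n)} (hD : ∀ a v, D (a, v) = a * α + inner ℝ v ξ) :
    (α, ξ) ∈ diniSubgradient Φ t x := by
  intro a v
  refine le_of_forall_lt_imp_le_of_dense fun c hc => ?_
  have h1 := hψ.tendsto_diniQuotient a v
  rw [hD] at h1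
  have h2 : Tendsto (fun p : ℝ × EuclideanSpace ℝ (Fin n) =>
      (((ψ (t + p.1 * a, x + p.1 • p.2) - ψ (t, x)) / p.1 : ℝ) : EReal)) (diniFilter t a v)
      (𝓝 ((a * α + inner ℝ v ξ : ℝ) : EReal)) :=
    (continuous_coe_real_ereal.tendsto _).comp h1
  refine le_liminf_of_le (by isBoundedDefault) ?_
  filter_upwards [h2.eventually_const_lt hc, (tendsto_diniPath t a x v).eventually hle,
    eventually_diniFilter_pos t a v] with p hp1 hp2 hp3
  refine hp1.le.trans ?_
  rw [diniQuotient, EReal.coe_le_coe_iff]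
  exact div_le_div_of_nonneg_right (hp2 hp3.2) hp3.1.le

/-- In forward directions the constraint on the time domain holds automatically, even at `t = 0`. -/
theorem tendsto_diniFilter_one {ι : Type*} {F : Filter ι} {h : ι → ℝ}
    {w : ι → EuclideanSpace ℝ (Fin n)} (ht : 0 ≤ t) (hh : Tendsto h F (𝓝[>] 0))
    (hw : Tendsto w F (𝓝 v)) : Tendsto (fun k => (h k, w k)) F (diniFilter t 1 v) := by
  refine tendsto_inf.2 ⟨hh.prodMk hw, tendsto_principal.2 ?_⟩
  filter_upwards [hh.eventually self_mem_nhdsWithin] with k hk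
  have : 0 < h k := hk
  change 0 ≤ t + h k * 1
  linarith

/-- A limsup dominates the quotients along any particular approach. A general filter covers curves
and sequences alike. -/
theorem le_upperDini_one {ι : Type*} {F : Filter ι} [F.NeBot] {h : ι → ℝ}
    {w : ι → EuclideanSpace ℝ (Fin n)} (ht : 0 ≤ t) (hh : Tendsto h F (𝓝[>] 0))
    (hw : Tendsto w F (𝓝 v)) {c : ℝ}
    (hc : ∀ᶠ k in F, c * h k ≤ Φ (t + h k) (x + h k • w k) - Φ t x) :
    (c : EReal) ≤ upperDini Φ t x 1 v := by
  refine le_limsup_of_frequently_le ?_ (by isBoundedDefault)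
  refine (tendsto_diniFilter_one ht hh hw).frequently (Eventually.frequently ?_)
  filter_upwards [hc, hh.eventually self_mem_nhdsWithin] with k hk hk'
  rw [diniQuotient, EReal.coe_le_coe_iff, le_div_iff₀ hk', mul_one]
  exact hk

theorem lowerDini_one_le {ι : Type*} {F : Filter ι} [F.NeBot] {h : ι → ℝ}
    {w : ι → EuclideanSpace ℝ (Fin n)} (ht : 0 ≤ t) (hh : Tendsto h F (𝓝[>] 0))
    (hw : Tendsto w F (𝓝 v)) {c : ℝ}
    (hc : ∀ᶠ k in F, Φ (t + h k) (x + h k • w k) - Φ t x ≤ c * h k) :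
    lowerDini Φ t x 1 v ≤ (c : EReal) := by
  refine liminf_le_of_frequently_le ?_ (by isBoundedDefault)
  refine (tendsto_diniFilter_one ht hh hw).frequently (Eventually.frequently ?_)
  filter_upwards [hc, hh.eventually self_mem_nhdsWithin] with k hk hk'
  rw [diniQuotient, EReal.coe_le_coe_iff, div_le_iff₀ hk', mul_one]
  exact hk

end Dini

/-! ### Short-time analysis; the value function is a Dini solution -/

namespace ControlProblem

variable {n m : ℕ}

namespace Standing

variable {P : ControlProblem n m} {K₁ K₂ : ℝ} (H : P.Standing K₁ K₂)
include H

theorem hamiltonian_le {t : ℝ} (ht : 0 ≤ t) (x ξ : EuclideanSpace ℝ (Fin n))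
    {v : EuclideanSpace ℝ (Fin m)} (hv : v ∈ P.Ω) :
    P.hamiltonian t x ξ ≤ inner ℝ ξ (P.f t x v) + P.discountedCost t x v := by
  refine csInf_le ?_ ⟨v, hv, rfl⟩
  refine ⟨-(‖ξ‖ * (K₁ * ‖x‖ + K₂)) - (K₁ * ‖x‖ + K₂), ?_⟩
  rintro _ ⟨u, hu, rfl⟩
  have h1 := (abs_le.1 (H.abs_discountedCost_le ht hu x)).1
  have h2 := (abs_le.1 (abs_real_inner_le_norm ξ (P.f t x u))).1
  have h3 := mul_le_mul_of_nonneg_left (H.norm_f_le ht hu x) (norm_nonneg ξ)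
  change _ ≤ inner ℝ ξ (P.f t x u) + P.discountedCost t x u
  linarith

theorem le_hamiltonian {t : ℝ} {x ξ : EuclideanSpace ℝ (Fin n)} {c : ℝ}
    (h : ∀ v ∈ P.Ω, c ≤ inner ℝ ξ (P.f t x v) + P.discountedCost t x v) :
    c ≤ P.hamiltonian t x ξ := by
  refine le_csInf (H.Ω_nonempty.image _) ?_
  rintro _ ⟨u, hu, rfl⟩
  exact h u hu

/-- Uniform continuity of the data on compact sets of times and states. -/
theorem exists_modulus (T R : ℝ) {κ : ℝ} (hκ : 0 < κ) :
    ∃ ρ > 0, ∀ t ∈ Icc 0 T, ∀ t' ∈ Icc 0 T, ∀ x y : EuclideanSpace ℝ (Fin n),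
      ‖x‖ ≤ R → ‖y‖ ≤ R → |t - t'| ≤ ρ → ‖x - y‖ ≤ ρ → ∀ v ∈ P.Ω,
      ‖P.f t x v - P.f t' y v‖ ≤ κ ∧
        |P.discountedCost t x v - P.discountedCost t' y v| ≤ κ := by
  set C : Set (ℝ × EuclideanSpace ℝ (Fin n) × EuclideanSpace ℝ (Fin m)) :=
    Icc 0 T ×ˢ (Metric.closedBall 0 R ×ˢ P.Ω)
  have hC : IsCompact C := isCompact_Icc.prod ((isCompact_closedBall _ _).prod H.Ω_compact)
  have hsub : C ⊆ Ici 0 ×ˢ univ := fun p hp => ⟨hp.1.1, mem_univ _⟩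
  have h1 := hC.uniformContinuousOn_of_continuous (H.f_cont.mono hsub)
  have h2 := hC.uniformContinuousOn_of_continuous (H.continuousOn_discountedCost.mono hsub)
  rw [Metric.uniformContinuousOn_iff_le] at h1 h2
  obtain ⟨ρ₁, hρ₁, h1⟩ := h1 κ hκ
  obtain ⟨ρ₂, hρ₂, h2⟩ := h2 κ hκ
  refine ⟨min ρ₁ ρ₂, lt_min hρ₁ hρ₂, fun t ht t' ht' x y hx hy htt hxy v hv => ?_⟩
  have hp : (t, x, v) ∈ C := ⟨ht, by simpa using hx, hv⟩
  have hq : (t', y, v) ∈ C := ⟨ht', by simpa using hy, hv⟩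
  have hd : dist (t, x, v) (t', y, v) ≤ min ρ₁ ρ₂ := by
    rw [Prod.dist_eq, Prod.dist_eq, dist_self, Real.dist_eq, dist_eq_norm]
    exact max_le htt (max_le hxy (lt_min hρ₁ hρ₂).le)
  have h3 := h1 _ hp _ hq (hd.trans (min_le_left _ _))
  have h4 := h2 _ hp _ hq (hd.trans (min_le_right _ _))
  rw [dist_eq_norm] at h3 h4
  exact ⟨h3, h4⟩

/-- Speed and cost bounds along a bounded piece of trajectory. -/
theorem norm_sub_le_of_norm_le {τ : ℝ} (hτ : 0 ≤ τ) {z : EuclideanSpace ℝ (Fin n)}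
    {x : ℝ → EuclideanSpace ℝ (Fin n)} {u : ℝ → EuclideanSpace ℝ (Fin m)}
    (h : (x, u) ∈ P.processes τ z) {s t R : ℝ} (hs : τ ≤ s) (hst : s ≤ t)
    (hR : ∀ r ∈ Icc s t, ‖x r‖ ≤ R) :
    ‖x t - x s‖ ≤ (K₁ * R + K₂) * (t - s) ∧
      |∫ r in s..t, P.runningCost x u r| ≤ (K₁ * R + K₂) * (t - s) := by
  have hb : ∀ r ∈ Icc s t, K₁ * ‖x r‖ + K₂ ≤ K₁ * R + K₂ := fun r hr => by
    have := mul_le_mul_of_nonneg_left (hR r hr) H.K₁_pos.le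
    linarith
  constructor
  · have htr : P.IsTrajectory τ z x u := h.2.1
    rw [(htr.sub_eq hs (hs.trans hst)).2, add_sub_cancel_left]
    refine (intervalIntegral.norm_integral_le_of_norm_le_const_ae
      (C := K₁ * R + K₂) ?_).trans_eq (by rw [abs_of_nonneg (by linarith)])
    filter_upwards [h.1.ae_mem] with r hr hr'
    rw [uIoc_of_le hst] at hr'
    have hr2 : τ ≤ r := hs.trans hr'.1.le
    exact (H.norm_f_le (hτ.trans hr2) (hr hr2) _).trans (hb r ⟨hr'.1.le, hr'.2⟩)
  · rw [← Real.norm_eq_abs]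
    refine (intervalIntegral.norm_integral_le_of_norm_le_const_ae
      (C := K₁ * R + K₂) ?_).trans_eq (by rw [abs_of_nonneg (by linarith)])
    filter_upwards [h.1.ae_mem] with r hr hr'
    rw [uIoc_of_le hst] at hr'
    have hr2 : τ ≤ r := hs.trans hr'.1.le
    exact (H.abs_discountedCost_le (hτ.trans hr2) (hr hr2) _).trans (hb r ⟨hr'.1.le, hr'.2⟩)

/-- Averages of velocity and cost along a process are nearly attained by a single control value,
because the extended velocity sets are convex. -/
theorem exists_control_average {τ : ℝ} (hτ : 0 ≤ τ) {z : EuclideanSpace ℝ (Fin n)}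
    {x : ℝ → EuclideanSpace ℝ (Fin n)} {u : ℝ → EuclideanSpace ℝ (Fin m)}
    (h : (x, u) ∈ P.processes τ z) {a b t κ : ℝ} (ha : τ ≤ a) (hab : a < b) (ht : 0 ≤ t)
    (y : EuclideanSpace ℝ (Fin n))
    (hκ : ∀ s ∈ Icc a b, ∀ v ∈ P.Ω, ‖P.f s (x s) v - P.f t y v‖ ≤ κ ∧
      |P.discountedCost s (x s) v - P.discountedCost t y v| ≤ κ) :
    ∃ v ∈ P.Ω, ‖x b - x a - (b - a) • P.f t y v‖ ≤ κ * (b - a) ∧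
      |(∫ s in a..b, P.runningCost x u s) - (b - a) * P.discountedCost t y v| ≤ κ * (b - a) := by
  have hb : τ ≤ b := ha.trans hab.le
  have hbnd : ∀ᵐ s ∂(volume.restrict (Ici τ)), u s ∈ P.Ω := h.1.2
  have hcf : Continuous fun v => P.f t y v :=
    H.f_cont.comp_continuous (f := fun v => (t, y, v)) (by fun_prop) (fun v => ⟨ht, mem_univ _⟩)
  have hcL : Continuous fun v => P.discountedCost t y v :=
    H.continuousOn_discountedCost.comp_continuous (f := fun v => (t, y, v)) (by fun_prop)
      (fun v => ⟨ht, mem_univ _⟩)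
  have hF : IntervalIntegrable (fun s => P.f t y (u s)) volume a b := by
    refine (hcf.comp_aestronglyMeasurable h.1.1.aestronglyMeasurable
      ).intervalIntegrable_of_le_continuousOn (B := fun _ => K₁ * ‖y‖ + K₂)
      continuousOn_const ?_ ha hb
    filter_upwards [hbnd] with s hs using H.norm_f_le ht hs y
  have hL : IntervalIntegrable (fun s => P.discountedCost t y (u s)) volume a b := by
    refine (hcL.comp_aestronglyMeasurable h.1.1.aestronglyMeasurable
      ).intervalIntegrable_of_le_continuousOn (B := fun _ => K₁ * ‖y‖ + K₂)
      continuousOn_const ?_ ha hb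
    filter_upwards [hbnd] with s hs using H.abs_discountedCost_le ht hs y
  have hFi := (intervalIntegrable_iff_integrableOn_Ioc_of_le hab.le).1 hF
  have hLi := (intervalIntegrable_iff_integrableOn_Ioc_of_le hab.le).1 hL
  -- With time and state frozen at `(t, y)`, cost and velocity lie in one closed convex set, so
  -- their joint average does too and is attained by a single control value. Freezing costs `κ` per
  -- unit of time.
  have hmem := (H.convex t ht y).set_average_mem (μ := volume) (t := Ioc a b)
    (f := fun s => (P.discountedCost t y (u s), P.f t y (u s)))
    ((H.Ω_compact.image (hcL.prodMk hcf)).isClosed) (by simp [hab]) (by simp)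
    (by
      filter_upwards [ae_mono (Measure.restrict_mono (fun s hs => ha.trans (le_of_lt hs.1) :
        Ioc a b ⊆ Ici τ) le_rfl) hbnd] with s hs
      exact ⟨u s, hs, rfl⟩)
    (hLi.prodMk hFi)
  rw [setAverage_eq, integral_pair hLi hFi, ← intervalIntegral.integral_of_le hab.le,
    ← intervalIntegral.integral_of_le hab.le] at hmem
  obtain ⟨v, hv, hveq⟩ := hmem
  have hba : 0 < b - a := by linarith
  simp only [Prod.smul_mk, Prod.mk.injEq, Measure.real, Real.volume_Ioc,
    ENNReal.toReal_ofReal hba.le] at hveq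
  have h1 : (b - a) • P.f t y v = ∫ s in a..b, P.f t y (u s) := by
    rw [hveq.2, smul_smul, mul_inv_cancel₀ hba.ne', one_smul]
  have h2 : (b - a) * P.discountedCost t y v = ∫ s in a..b, P.discountedCost t y (u s) := by
    rw [hveq.1, smul_eq_mul, mul_inv_cancel_left₀ hba.ne']
  refine ⟨v, hv, ?_, ?_⟩
  · have htr : P.IsTrajectory τ z x u := h.2.1
    have h3 := htr.sub_eq ha hb
    rw [h1, h3.2, add_sub_cancel_left,
      ← intervalIntegral.integral_sub h3.1 hF]
    refine (intervalIntegral.norm_integral_le_of_norm_le_const_ae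
      (C := κ) ?_).trans_eq (by rw [abs_of_pos hba])
    filter_upwards [h.1.ae_mem] with r hr hr'
    rw [uIoc_of_le hab.le] at hr'
    exact (hκ r ⟨hr'.1.le, hr'.2⟩ _ (hr (ha.trans hr'.1.le))).1
  · rw [h2, ← intervalIntegral.integral_sub
      (H.intervalIntegrable_runningCost hτ h.2.1.continuousOn h.1 ha hb) hL, ← Real.norm_eq_abs]
    refine (intervalIntegral.norm_integral_le_of_norm_le_const_ae
      (C := κ) ?_).trans_eq (by rw [abs_of_pos hba])
    filter_upwards [h.1.ae_mem] with r hr hr'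
    rw [uIoc_of_le hab.le] at hr'
    exact (hκ r ⟨hr'.1.le, hr'.2⟩ _ (hr (ha.trans hr'.1.le))).2

/-- Bound on the norm of trajectories during one unit of time. -/
theorem norm_trajectory_le_unit {τ : ℝ} (hτ : 0 ≤ τ) {z : EuclideanSpace ℝ (Fin n)}
    {x : ℝ → EuclideanSpace ℝ (Fin n)} {u : ℝ → EuclideanSpace ℝ (Fin m)}
    (h : (x, u) ∈ P.processes τ z) {t : ℝ} (ht : τ ≤ t) (ht1 : t ≤ τ + 1) :
    ‖x t‖ ≤ (‖z‖ + K₂ / K₁) * Real.exp K₁ := by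
  refine (H.norm_trajectory_le hτ h.1 h.2.1 ht).trans ?_
  have hK := H.K₁_pos
  have hK2 := H.K₂_pos
  gcongr
  nlinarith

/-- The point is that `M` does not depend on the control, so short-time estimates hold for all
processes at once. -/
theorem norm_trajectory_sub_le_unit {τ : ℝ} (hτ : 0 ≤ τ) (z : EuclideanSpace ℝ (Fin n)) :
    ∃ M, 0 < M ∧ ∀ x u, (x, u) ∈ P.processes τ z → ∀ t, τ ≤ t → t ≤ τ + 1 →
      ‖x t - z‖ ≤ M * (t - τ) ∧ |∫ r in τ..t, P.runningCost x u r| ≤ M * (t - τ) := by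
  have hK := H.K₁_pos
  have hK2 := H.K₂_pos
  refine ⟨K₁ * ((‖z‖ + K₂ / K₁) * Real.exp K₁) + K₂, by positivity, fun x u h t ht ht1 => ?_⟩
  have := H.norm_sub_le_of_norm_le hτ h (R := (‖z‖ + K₂ / K₁) * Real.exp K₁) le_rfl ht
    (fun r hr => H.norm_trajectory_le_unit hτ h hr.1 (hr.2.trans ht1))
  have hz : x τ = z := h.2.1.apply_self
  rwa [hz] at this

/-- Local Lipschitz continuity of the value function in time. -/
theorem abs_value_sub_le_time (z : EuclideanSpace ℝ (Fin n)) :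
    ∃ C, 0 < C ∧ ∀ τ s, 0 ≤ τ → τ ≤ s → s ≤ τ + 1 →
      |P.value τ z - P.value s z| ≤ C * (s - τ) := by
  have hK := H.K₁_pos
  have hK2 := H.K₂_pos
  have hpos : 0 < P.δ - K₁ := by linarith [H.K₁_lt]
  set R := (‖z‖ + K₂ / K₁) * Real.exp K₁ with hR
  have hRpos : 0 < R := by positivity
  set M := K₁ * R + K₂ with hM
  have hMpos : 0 < M := by positivity
  refine ⟨M + K₁ / (P.δ - K₁) * M, by positivity, fun τ s hτ hs hs1 => ?_⟩
  have key : ∀ x u, (x, u) ∈ P.processes τ z →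
      |∫ r in τ..s, P.runningCost x u r| ≤ M * (s - τ) ∧
      |P.value s (x s) - P.value s z| ≤ K₁ / (P.δ - K₁) * M * (s - τ) := by
    intro x u h
    have h1 := H.norm_sub_le_of_norm_le hτ h (R := R) le_rfl hs
      (fun r hr => H.norm_trajectory_le_unit hτ h hr.1 (hr.2.trans hs1))
    have hz : x τ = z := h.2.1.apply_self
    rw [hz] at h1
    refine ⟨h1.2, (H.abs_value_sub_le (hτ.trans hs) _ _).trans ?_⟩
    rw [mul_assoc]
    exact mul_le_mul_of_nonneg_left h1.1 (by positivity)
  rw [abs_le]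
  -- The lower bound needs every process from `(τ, z)`; for the upper bound one constant control
  -- suffices.
  constructor
  · suffices P.value s z - (M + K₁ / (P.δ - K₁) * M) * (s - τ) ≤ P.value τ z by linarith
    refine H.le_value hτ fun x u h => ?_
    have h1 := H.integral_add_value_le_cost hτ hs h
    have h2 := key x u h
    linarith [(abs_le.1 h2.1).1, (abs_le.1 h2.2).1]
  · obtain ⟨v, hv⟩ := H.Ω_nonempty
    obtain ⟨x, h⟩ := H.exists_const_mem_processes hτ z hv
    have h1 := H.value_le_integral_add hτ hs h
    have h2 := key x _ h
    linarith [(abs_le.1 h2.1).2, (abs_le.1 h2.2).2]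

theorem continuousOn_value :
    ContinuousOn (fun p : ℝ × EuclideanSpace ℝ (Fin n) => P.value p.1 p.2) (Ici 0 ×ˢ univ) := by
  rintro ⟨t, z⟩ ⟨ht, -⟩
  have ht0 : 0 ≤ t := ht
  obtain ⟨C, hC, hCb⟩ := H.abs_value_sub_le_time z
  refine tendsto_iff_dist_tendsto_zero.2 ?_
  have hlim : Tendsto (fun p : ℝ × EuclideanSpace ℝ (Fin n) =>
      K₁ / (P.δ - K₁) * ‖p.2 - z‖ + C * |p.1 - t|) (𝓝[Ici 0 ×ˢ univ] (t, z)) (𝓝 0) := by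
    have hc : Continuous fun p : ℝ × EuclideanSpace ℝ (Fin n) =>
      K₁ / (P.δ - K₁) * ‖p.2 - z‖ + C * |p.1 - t| := by fun_prop
    have := hc.tendsto (t, z)
    simp only [sub_self, norm_zero, mul_zero, abs_zero, add_zero] at this
    exact this.mono_left nhdsWithin_le_nhds
  refine squeeze_zero' (Eventually.of_forall fun _ => dist_nonneg) ?_ hlim
  have hnear : ∀ᶠ p : ℝ × EuclideanSpace ℝ (Fin n) in 𝓝[Ici 0 ×ˢ univ] (t, z),
      |p.1 - t| < 1 := by
    have hc : Continuous fun p : ℝ × EuclideanSpace ℝ (Fin n) => |p.1 - t| := by fun_prop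
    have := hc.tendsto (t, z)
    simp only [sub_self, abs_zero] at this
    exact (this.mono_left nhdsWithin_le_nhds).eventually_lt_const one_pos
  filter_upwards [hnear, self_mem_nhdsWithin] with p hp hp'
  have hp0 : 0 ≤ p.1 := hp'.1
  rw [Real.dist_eq]
  have h1 := H.abs_value_sub_le hp0 p.2 z
  -- Times are compared only at the fixed state `z`, on which `C` depends; `C` is uniform in the
  -- starting time, so either time may be the earlier one.
  have h2 : |P.value p.1 z - P.value t z| ≤ C * |p.1 - t| := by
    rcases le_total p.1 t with hpt | hpt
    · have := hCb p.1 t hp0 hpt (by linarith [(abs_lt.1 hp).1])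
      rwa [abs_sub_comm p.1 t, abs_of_nonneg (by linarith : 0 ≤ t - p.1)]
    · have := hCb t p.1 ht0 hpt (by linarith [(abs_lt.1 hp).2])
      rw [abs_sub_comm]
      rwa [abs_of_nonneg (by linarith : 0 ≤ p.1 - t)]
  calc |P.value p.1 p.2 - P.value t z|
      = |(P.value p.1 p.2 - P.value p.1 z) + (P.value p.1 z - P.value t z)| := by ring_nf
    _ ≤ _ := (abs_add_le _ _).trans (add_le_add h1 h2)

/-- Short-time behaviour of all processes: on `[t, t + h]` velocity and running cost are, on
average, close to those of a single control value at the initial point. -/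
theorem exists_short_time {t : ℝ} (ht : 0 ≤ t) (y : EuclideanSpace ℝ (Fin n)) {κ : ℝ}
    (hκ : 0 < κ) : ∃ h₀ > 0, ∀ s ∈ Icc t (t + h₀), ∀ x u, (x, u) ∈ P.processes t y →
      ∀ v ∈ P.Ω, ‖P.f s (x s) v - P.f t y v‖ ≤ κ ∧
        |P.discountedCost s (x s) v - P.discountedCost t y v| ≤ κ := by
  obtain ⟨M, hM, hMb⟩ := H.norm_trajectory_sub_le_unit ht y
  obtain ⟨ρ, hρ, hρb⟩ := H.exists_modulus (t + 1) (‖y‖ + M) hκ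
  refine ⟨min 1 (min ρ (ρ / M)), by positivity, fun s hs x u hp v hv => ?_⟩
  have hs1 : s ≤ t + 1 := hs.2.trans (by gcongr; exact min_le_left _ _)
  have hs2 : s - t ≤ ρ := by
    have := hs.2.trans (add_le_add_right ((min_le_right 1 _).trans (min_le_left ρ (ρ / M))) t)
    linarith
  have hs3 : s - t ≤ ρ / M := by
    have := hs.2.trans (add_le_add_right ((min_le_right 1 _).trans (min_le_right ρ (ρ / M))) t)
    linarith
  have h1 := (hMb x u hp s hs.1 hs1).1
  have h2 : M * (s - t) ≤ M := mul_le_of_le_one_right hM.le (by linarith)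
  have h3 : M * (s - t) ≤ ρ := by rw [mul_comm]; exact (le_div_iff₀ hM).1 hs3
  refine hρb s ⟨ht.trans hs.1, hs1⟩ t ⟨ht, by linarith⟩ (x s) y ?_ (by linarith) ?_ (by linarith)
    v hv
  · have := norm_sub_norm_le (x s) y
    linarith
  · rw [abs_of_nonneg (by linarith [hs.1])]; exact hs2

/-- Short-time expansion of the trajectories of constant controls. -/
theorem exists_const_expansion {t : ℝ} (ht : 0 ≤ t) (y : EuclideanSpace ℝ (Fin n)) {κ : ℝ}
    (hκ : 0 < κ) : ∃ h₀ > 0, ∀ h ∈ Ioc 0 h₀, ∀ v ∈ P.Ω, ∀ x,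
      (x, fun _ => v) ∈ P.processes t y →
      ‖x (t + h) - y - h • P.f t y v‖ ≤ κ * h ∧
        |(∫ s in t..(t + h), P.runningCost x (fun _ => v) s) - h * P.discountedCost t y v|
          ≤ κ * h := by
  obtain ⟨h₀, hh₀, hb⟩ := H.exists_short_time ht y hκ
  refine ⟨h₀, hh₀, fun h hh v hv x hp => ?_⟩
  have hlt : t < t + h := by linarith [hh.1]
  have hb' : ∀ r ∈ uIoc t (t + h), ‖P.f r (x r) v - P.f t y v‖ ≤ κ ∧
      |P.discountedCost r (x r) v - P.discountedCost t y v| ≤ κ := by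
    intro r hr
    rw [uIoc_of_le hlt.le] at hr
    exact hb r ⟨hr.1.le, hr.2.trans (by linarith [hh.2])⟩ x _ hp v hv
  constructor
  · have htr : P.IsTrajectory t y x (fun _ => v) := hp.2.1
    have h1 := htr (t + h) hlt.le
    have h2 : h • P.f t y v = ∫ _ in t..(t + h), P.f t y v := by simp
    rw [h2, h1.2, add_sub_cancel_left,
      ← intervalIntegral.integral_sub h1.1 intervalIntegrable_const]
    exact (intervalIntegral.norm_integral_le_of_norm_le_const fun r hr => (hb' r hr).1).trans_eq
      (by rw [add_sub_cancel_left, abs_of_pos hh.1])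
  · have h2 : h * P.discountedCost t y v = ∫ _ in t..(t + h), P.discountedCost t y v := by simp
    rw [h2, ← intervalIntegral.integral_sub (H.intervalIntegrable_runningCost ht
      hp.2.1.continuousOn hp.1 le_rfl hlt.le) intervalIntegrable_const, ← Real.norm_eq_abs]
    exact (intervalIntegral.norm_integral_le_of_norm_le_const fun r hr => (hb' r hr).2).trans_eq
      (by rw [add_sub_cancel_left, abs_of_pos hh.1])

/-- For each control value `v`, the super-gradient is tested in the direction `(1, f(t,x,v))` along
the trajectory of the constant control. Dynamic programming bounds the upper Dini derivative there
from below by minus the cost rate. -/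
theorem isDiniSubsolution_value : P.IsDiniSubsolution P.value := by
  refine ⟨H.continuousOn_value, fun t ht x p hp => ?_, H.hasDecay_value⟩
  suffices -p.1 ≤ P.hamiltonian t x p.2 by linarith
  refine H.le_hamiltonian fun v hv => ?_
  obtain ⟨X, hX⟩ := H.exists_const_mem_processes ht x hv
  have hexp : ∀ κ > 0, ∀ᶠ h in 𝓝[>] (0 : ℝ), 0 < h ∧ ‖X (t + h) - x - h • P.f t x v‖ ≤ κ * h ∧
      |(∫ s in t..(t + h), P.runningCost X (fun _ => v) s) - h * P.discountedCost t x v|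
        ≤ κ * h := by
    intro κ hκ
    obtain ⟨h₀, hh₀, hb⟩ := H.exists_const_expansion ht x hκ
    filter_upwards [Ioc_mem_nhdsGT hh₀] with h hh using ⟨hh.1, hb h hh v hv X hX⟩
  have hw : Tendsto (fun h : ℝ => h⁻¹ • (X (t + h) - x)) (𝓝[>] 0) (𝓝 (P.f t x v)) := by
    rw [Metric.tendsto_nhds]
    intro ε hε
    filter_upwards [hexp (ε / 2) (by positivity)] with h hh
    rw [dist_eq_norm]
    have : h⁻¹ • (X (t + h) - x) - P.f t x v = h⁻¹ • (X (t + h) - x - h • P.f t x v) := by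
      rw [smul_sub h⁻¹ (X (t + h) - x), smul_smul, inv_mul_cancel₀ hh.1.ne', one_smul]
    rw [this, norm_smul, norm_inv, Real.norm_of_nonneg hh.1.le, inv_mul_lt_iff₀ hh.1]
    nlinarith [hh.2.1, hh.1]
  refine le_of_forall_pos_le_add fun ε hε => ?_
  have h1 : ((-(P.discountedCost t x v) - ε : ℝ) : EReal) ≤
      upperDini P.value t x 1 (P.f t x v) := by
    refine le_upperDini_one ht tendsto_id hw ?_
    filter_upwards [hexp ε hε] with h hh
    have h2 := H.value_le_integral_add ht (by linarith [hh.1] : t ≤ t + h) hX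
    rw [id, smul_smul, mul_inv_cancel₀ hh.1.ne', one_smul, add_sub_cancel]
    linarith [(abs_le.1 hh.2.2).2]
  have h3 := h1.trans (hp 1 (P.f t x v))
  rw [EReal.coe_le_coe_iff, real_inner_comm] at h3
  linarith

/-- If `Φ` decreases, up to an arbitrarily small error, at the rate of the cost along short
segments with nearly admissible velocity, then sub-gradients satisfy the Hamilton-Jacobi
inequality. -/
theorem add_hamiltonian_nonpos_of_forall_step {Φ : ℝ → EuclideanSpace ℝ (Fin n) → ℝ}
    {t : ℝ} (ht : 0 ≤ t) (x : EuclideanSpace ℝ (Fin n))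
    (hstep : ∀ ε > 0, ∃ h ∈ Ioo 0 ε, ∃ v ∈ P.Ω, ∃ w, ‖w - P.f t x v‖ ≤ ε ∧
      Φ (t + h) (x + h • w) + h * P.discountedCost t x v ≤ Φ t x + ε * h)
    {p : ℝ × EuclideanSpace ℝ (Fin n)} (hp : p ∈ diniSubgradient Φ t x) :
    p.1 + P.hamiltonian t x p.2 ≤ 0 := by
  choose h hh v hv w hw hΦ using fun k : ℕ => hstep (1 / ((k : ℝ) + 1)) (by positivity)
  -- Compactness of `Ω` selects one limiting control value; the sub-gradient is tested in its
  -- direction `(1, f(t,x,v₀))`.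
  obtain ⟨v₀, hv₀, σ, hσ, hlim⟩ := H.Ω_compact.tendsto_subseq hv
  have hε : Tendsto (fun k => 1 / ((σ k : ℝ) + 1)) atTop (𝓝 0) :=
    tendsto_one_div_add_atTop_nhds_zero_nat.comp hσ.tendsto_atTop
  have hcf : Continuous fun v => P.f t x v :=
    H.f_cont.comp_continuous (f := fun v => (t, x, v)) (by fun_prop) (fun v => ⟨ht, mem_univ _⟩)
  have hcL : Continuous fun v => P.discountedCost t x v :=
    H.continuousOn_discountedCost.comp_continuous (f := fun v => (t, x, v)) (by fun_prop)
      (fun v => ⟨ht, mem_univ _⟩)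
  have hf := (hcf.tendsto v₀).comp hlim
  have hL := (hcL.tendsto v₀).comp hlim
  have hwlim : Tendsto (fun k => w (σ k)) atTop (𝓝 (P.f t x v₀)) := by
    have h1 : Tendsto (fun k => w (σ k) - P.f t x (v (σ k))) atTop (𝓝 0) :=
      squeeze_zero_norm (fun k => hw (σ k)) hε
    simpa using h1.add hf
  have hhlim : Tendsto (fun k => h (σ k)) atTop (𝓝[>] 0) := by
    refine tendsto_nhdsWithin_iff.2 ⟨?_, Eventually.of_forall fun k => (hh (σ k)).1⟩
    exact squeeze_zero (fun k => (hh _).1.le) (fun k => (hh _).2.le) hε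
  have hham := H.hamiltonian_le ht x p.2 hv₀
  suffices p.1 + inner ℝ p.2 (P.f t x v₀) ≤ -P.discountedCost t x v₀ by linarith
  refine le_of_forall_pos_le_add fun η hη => ?_
  have h1 : lowerDini Φ t x 1 (P.f t x v₀) ≤ ((-P.discountedCost t x v₀ + η : ℝ) : EReal) := by
    refine lowerDini_one_le ht hhlim hwlim ?_
    filter_upwards [hε.eventually_lt_const (half_pos hη),
      hL.eventually_const_lt (sub_lt_self _ (half_pos hη))] with k hk1 hk2
    have h2 := hΦ (σ k)
    have h3 := (hh (σ k)).1
    simp only [Function.comp_apply] at hk2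
    nlinarith
  have h3 := (hp 1 (P.f t x v₀)).trans h1
  rw [EReal.coe_le_coe_iff, real_inner_comm] at h3
  linarith

/-- A process nearly optimal on the scale of the step `h` supplies the required segment. Its mean
velocity is used as `w`, and convexity provides the matching `v`. -/
theorem isDiniSupersolution_value : P.IsDiniSupersolution P.value := by
  refine ⟨H.continuousOn_value, fun t ht x p hp => ?_, H.hasDecay_value⟩
  refine H.add_hamiltonian_nonpos_of_forall_step ht x (fun ε hε => ?_) hp
  obtain ⟨h₀, hh₀, hb⟩ := H.exists_short_time ht x (half_pos hε)
  set h := min h₀ (ε / 2) with hh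
  have hpos : 0 < h := by positivity
  -- The optimality gap must be proportional to `h`, so that it survives division by `h`.
  obtain ⟨X, u, hX, hcost⟩ := H.exists_cost_lt ht x (mul_pos (half_pos hε) hpos)
  obtain ⟨v, hv, h1, h2⟩ := H.exists_control_average ht hX le_rfl (by linarith : t < t + h) ht x
    (fun s hs v hv => hb s ⟨hs.1, hs.2.trans (by gcongr; exact min_le_left _ _)⟩ X u hX v hv)
  have hz : X t = x := hX.2.1.apply_self
  rw [add_sub_cancel_left, hz] at h1
  rw [add_sub_cancel_left] at h2
  refine ⟨h, ⟨hpos, (min_le_right _ _).trans_lt (half_lt_self hε)⟩, v, hv,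
    h⁻¹ • (X (t + h) - x), ?_, ?_⟩
  · have : h⁻¹ • (X (t + h) - x) - P.f t x v = h⁻¹ • (X (t + h) - x - h • P.f t x v) := by
      rw [smul_sub h⁻¹ (X (t + h) - x), smul_smul, inv_mul_cancel₀ hpos.ne', one_smul]
    rw [this, norm_smul, norm_inv, Real.norm_of_nonneg hpos.le, inv_mul_le_iff₀ hpos]
    nlinarith
  · rw [smul_smul, mul_inv_cancel₀ hpos.ne', one_smul, add_sub_cancel]
    have h3 := H.integral_add_value_le_cost ht (by linarith : t ≤ t + h) hX
    linarith [(abs_le.1 h2).1]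

end Standing

end ControlProblem

/-! ### Steklov averages and comparison for sub-solutions -/

/-- Steklov averages of continuous functions are continuously differentiable. -/
theorem Continuous.hasDerivAt_steklov {E : Type*} [NormedAddCommGroup E] [NormedSpace ℝ E]
    [CompleteSpace E] {X : ℝ → E} (hX : Continuous X) (h t : ℝ) :
    HasDerivAt (fun t => h⁻¹ • ∫ r in t..(t + h), X r) (h⁻¹ • (X (t + h) - X t)) t := by
  have hI : ∀ t, HasDerivAt (fun t => ∫ r in (0 : ℝ)..t, X r) (X t) t := fun t =>
    intervalIntegral.integral_hasDerivAt_right (hX.intervalIntegrable _ _)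
      (hX.stronglyMeasurableAtFilter _ _) hX.continuousAt
  have h1 := ((HasDerivAt.comp_add_const t h (hI (t + h))).sub (hI t)).const_smul h⁻¹
  refine h1.congr_of_eventuallyEq (Eventually.of_forall fun s => ?_)
  simp only [Pi.smul_apply, Pi.sub_apply]
  rw [intervalIntegral.integral_interval_sub_left (hX.intervalIntegrable _ _)
    (hX.intervalIntegrable _ _)]

theorem Continuous.norm_steklov_sub_le {E : Type*} [NormedAddCommGroup E] [NormedSpace ℝ E]
    [CompleteSpace E] {X : ℝ → E} (hX : Continuous X) {h t κ : ℝ} (hh : 0 < h)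
    (hκ : ∀ r ∈ Icc t (t + h), ‖X r - X t‖ ≤ κ) :
    ‖(h⁻¹ • ∫ r in t..(t + h), X r) - X t‖ ≤ κ := by
  have h1 : X t = h⁻¹ • ∫ _ in t..(t + h), X t := by
    simp [smul_smul, inv_mul_cancel₀ hh.ne']
  conv_lhs => rw [h1]
  rw [← smul_sub, ← intervalIntegral.integral_sub (hX.intervalIntegrable _ _)
    intervalIntegrable_const, norm_smul, norm_inv, Real.norm_of_nonneg hh.le, inv_mul_le_iff₀ hh]
  refine (intervalIntegral.norm_integral_le_of_norm_le_const (C := κ) fun r hr => ?_).trans_eq ?_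
  · rw [uIoc_of_le (by linarith)] at hr
    exact hκ r ⟨hr.1.le, hr.2⟩
  · rw [add_sub_cancel_left, abs_of_pos hh, mul_comm]

namespace ControlProblem

variable {n m : ℕ}

namespace Standing

variable {P : ControlProblem n m} {K₁ K₂ : ℝ} (H : P.Standing K₁ K₂)
include H

omit H in
/-- The derivative of the penalty function used in the comparison along a smooth curve. -/
theorem hasFDerivAt_tube_penalty {p : ℝ → EuclideanSpace ℝ (Fin n)}
    {p' : EuclideanSpace ℝ (Fin n)} {g e : ℝ → ℝ} {g' e' t : ℝ} (y : EuclideanSpace ℝ (Fin n))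
    (hp : HasDerivAt p p' t) (hg : HasDerivAt g g' t) (he : HasDerivAt e e' t) :
    ∃ D : ℝ × EuclideanSpace ℝ (Fin n) →L[ℝ] ℝ,
      HasFDerivAt (fun q : ℝ × EuclideanSpace ℝ (Fin n) =>
        g q.1 + e q.1 * ‖q.2 - p q.1‖ ^ 2) D (t, y) ∧
      ∀ a v, D (a, v) = a * (g' + e' * ‖y - p t‖ ^ 2 - 2 * e t * inner ℝ (y - p t) p') +
        inner ℝ v ((2 * e t) • (y - p t)) := by
  have hfst : HasFDerivAt (fun q : ℝ × EuclideanSpace ℝ (Fin n) => q.1)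
    (ContinuousLinearMap.fst ℝ ℝ _) (t, y) := hasFDerivAt_fst
  have hsnd : HasFDerivAt (fun q : ℝ × EuclideanSpace ℝ (Fin n) => q.2)
    (ContinuousLinearMap.snd ℝ ℝ _) (t, y) := hasFDerivAt_snd
  have h1 := (hg.hasFDerivAt (x := t)).comp (t, y) hfst
  have h2 := (he.hasFDerivAt (x := t)).comp (t, y) hfst
  have h3 := (hp.hasFDerivAt (x := t)).comp (t, y) hfst
  have h4 := h1.add (h2.mul (hsnd.sub h3).norm_sq)
  refine ⟨_, h4, fun a v => ?_⟩
  simp [inner_sub_right, inner_smul_right, real_inner_comm]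
  ring

/-- Comparison of a sub-solution along a smooth curve whose velocity is nearly admissible. -/
theorem subsolution_le_along_curve {Φ : ℝ → EuclideanSpace ℝ (Fin n) → ℝ}
    (hΦ : P.IsDiniSubsolution Φ) {s T : ℝ} (hs : 0 ≤ s)
    {p p' : ℝ → EuclideanSpace ℝ (Fin n)} {c c' : ℝ → ℝ}
    (hp : ∀ t, HasDerivAt p (p' t) t) (hc : ∀ t, HasDerivAt c (c' t) t)
    {M κ k ρ γ : ℝ} (hM : ∀ t ∈ Icc s T, ∀ b, ‖b‖ ≤ 1 → |Φ t (p t + b)| ≤ M)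
    (hκ : 0 ≤ κ) (happrox : ∀ t ∈ Ioo s T, ∃ v ∈ P.Ω,
      ‖p' t - P.f t (p t) v‖ ≤ κ ∧ |c' t + P.discountedCost t (p t) v| ≤ κ)
    (hk : 0 < k) (hρ : 0 < ρ) (hρ1 : ρ < 1)
    (hkρ : 2 * M < k * Real.exp (-(2 * K₁) * T) * ρ ^ 2)
    (hγ : K₁ * ρ + κ * (1 + 2 * k) < γ) {t₁ η : ℝ} (ht₁ : t₁ ∈ Ioo s T) (hη : 0 < η) :
    ∃ b, ‖b‖ ≤ ρ ∧
      Φ t₁ (p t₁) - c t₁ ≤ Φ T (p T + b) - c T + γ * (T - t₁) + η := by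
  have hK := H.K₁_pos
  have hsT : s < T := ht₁.1.trans ht₁.2
  have hγ0 : 0 < γ := lt_of_le_of_lt (by positivity) hγ
  -- The barrier `B / (t - s + σ)` costs at most `η` at `t₁`, but equals `Q` at `t = s`, enough to
  -- keep the maximum away from the left end. The shift `σ` keeps it finite on the closed interval.
  set B := η * (t₁ - s) with hB
  have hBpos : 0 < B := mul_pos hη (by linarith [ht₁.1])
  set Q := |2 * M + (c t₁ - c s) + η + γ * (T - t₁)| + 1 with hQ
  have hQpos : 0 < Q := by positivity
  set σ := B / Q with hσ
  have hσpos : 0 < σ := div_pos hBpos hQpos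
  set g : ℝ → ℝ := fun t => c t + B / (t - s + σ) + γ * (T - t) with hg
  -- The decay rate `2 * K₁` cancels the term `2 e K₁ ‖b‖²` produced by the Lipschitz dependence of
  -- the velocity on the state.
  set e : ℝ → ℝ := fun t => k * Real.exp (-(2 * K₁) * t) with he
  have hepos : ∀ t, 0 < e t := fun t => mul_pos hk (Real.exp_pos _)
  have hpc : Continuous p := continuous_iff_continuousAt.2 fun t => (hp t).continuousAt
  have hcc : Continuous c := continuous_iff_continuousAt.2 fun t => (hc t).continuousAt
  set J : ℝ × EuclideanSpace ℝ (Fin n) → ℝ := fun q =>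
    Φ q.1 (p q.1 + q.2) - g q.1 - e q.1 * ‖q.2‖ ^ 2 with hJ
  set C : Set (ℝ × EuclideanSpace ℝ (Fin n)) := Icc s T ×ˢ Metric.closedBall 0 1
  have hC : IsCompact C := isCompact_Icc.prod (isCompact_closedBall _ _)
  have hden : ∀ t ∈ Icc s T, 0 < t - s + σ := fun t ht => by linarith [ht.1]
  have hJc : ContinuousOn J C := by
    have h1 : ContinuousOn (fun q : ℝ × EuclideanSpace ℝ (Fin n) => Φ q.1 (p q.1 + q.2)) C :=
      hΦ.continuousOn.comp (f := fun q : ℝ × EuclideanSpace ℝ (Fin n) => (q.1, p q.1 + q.2))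
        (by fun_prop) (fun q hq => ⟨hs.trans hq.1.1, mem_univ _⟩)
    have h2 : ContinuousOn (fun q : ℝ × EuclideanSpace ℝ (Fin n) => g q.1) C := by
      simp only [hg]
      refine ContinuousOn.add (ContinuousOn.add (by fun_prop) ?_) (by fun_prop)
      exact ContinuousOn.div (by fun_prop) (by fun_prop) (fun q hq => (hden q.1 hq.1).ne')
    have h3 : Continuous (fun q : ℝ × EuclideanSpace ℝ (Fin n) => e q.1 * ‖q.2‖ ^ 2) := by
      simp only [he]; fun_prop
    exact (h1.sub h2).sub h3.continuousOn
  obtain ⟨⟨t₀, b₀⟩, ⟨ht₀, hb₀⟩, hmax⟩ := hC.exists_isMaxOn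
    ⟨(s, 0), ⟨le_rfl, hsT.le⟩, by simp⟩ hJc
  have hmax' : ∀ t ∈ Icc s T, ∀ b, ‖b‖ ≤ 1 → J (t, b) ≤ J (t₀, b₀) := fun t ht b hb =>
    hmax ⟨ht, by simpa using hb⟩
  simp only [mem_closedBall_zero_iff] at hb₀
  simp only at ht₀
  -- Comparison with `b = 0` at the same time bounds the penalty by `2 * M`, so the maximiser stays
  -- off the boundary of the tube.
  have hb₀ρ : ‖b₀‖ < ρ := by
    have h1 := hmax' t₀ ht₀ 0 (by simp)
    simp only [hJ, add_zero, norm_zero, ne_eq, OfNat.ofNat_ne_zero, not_false_eq_true,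
      zero_pow, mul_zero, sub_zero] at h1
    have h2 := (abs_le.1 (hM t₀ ht₀ b₀ hb₀)).2
    have h3 := (abs_le.1 (hM t₀ ht₀ 0 (by simp))).1
    rw [add_zero] at h3
    have h4 : k * Real.exp (-(2 * K₁) * T) * ρ ^ 2 ≤ e t₀ * ρ ^ 2 := by
      have : Real.exp (-(2 * K₁) * T) ≤ Real.exp (-(2 * K₁) * t₀) :=
        Real.exp_le_exp.2 (by nlinarith [ht₀.2])
      simp only [he]
      gcongr
    have h5 : e t₀ * ‖b₀‖ ^ 2 < e t₀ * ρ ^ 2 := by linarith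
    exact lt_of_pow_lt_pow_left₀ 2 hρ.le (lt_of_mul_lt_mul_left h5 (hepos _).le)
  have ht₁J := hmax' t₁ ⟨ht₁.1.le, ht₁.2.le⟩ 0 (by simp)
  simp only [hJ, hg, add_zero, norm_zero, ne_eq, OfNat.ofNat_ne_zero, not_false_eq_true,
    zero_pow, mul_zero, sub_zero] at ht₁J
  have hBt₁ : B / (t₁ - s + σ) ≤ η := by
    rw [div_le_iff₀ (hden t₁ ⟨ht₁.1.le, ht₁.2.le⟩)]
    nlinarith
  have heb : 0 ≤ e t₀ * ‖b₀‖ ^ 2 := mul_nonneg (hepos _).le (by positivity)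
  have hBt₀ : 0 ≤ B / (t₀ - s + σ) := (div_pos hBpos (hden t₀ ht₀)).le
  rcases eq_or_lt_of_le ht₀.2 with htT | htT
  · refine ⟨b₀, hb₀ρ.le, ?_⟩
    rw [htT] at ht₁J heb hBt₀
    simp only [sub_self, mul_zero, add_zero] at ht₁J
    linarith
  exfalso
  have hst₀ : s < t₀ := by
    refine lt_of_le_of_ne ht₀.1 fun hst => ?_
    rw [← hst] at ht₁J heb
    have h2 := (abs_le.1 (hM s ⟨le_rfl, hsT.le⟩ b₀ hb₀)).2
    have h3 := (abs_le.1 (hM t₁ ⟨ht₁.1.le, ht₁.2.le⟩ 0 (by simp))).1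
    rw [add_zero] at h3
    have h4 : B / (s - s + σ) = Q := by
      rw [sub_self, zero_add, hσ, div_div_cancel₀ hBpos.ne']
    have h5 := le_abs_self (2 * M + (c t₁ - c s) + η + γ * (T - t₁))
    have h6 : 0 ≤ γ * (T - s) := mul_nonneg hγ0.le (by linarith)
    linarith
  -- At an interior maximum the penalty touches `Φ` from above. With this `v`, the slope `-γ` makes
  -- the Hamilton-Jacobi expression negative, contradicting the sub-solution inequality.
  obtain ⟨v, hv, hv1, hv2⟩ := happrox t₀ ⟨hst₀, htT⟩
  have ht₀0 : 0 ≤ t₀ := hs.trans hst₀.le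
  have hd := hden t₀ ht₀
  have hgd : HasDerivAt g (c' t₀ - B / (t₀ - s + σ) ^ 2 - γ) t₀ := by
    have h1 : HasDerivAt (fun t => t - s + σ) 1 t₀ :=
      ((hasDerivAt_id t₀).sub_const s).add_const σ
    have h2 := (h1.fun_inv hd.ne').const_mul B
    have h3 : HasDerivAt (fun t => γ * (T - t)) (γ * (-1)) t₀ :=
      ((hasDerivAt_id t₀).const_sub T).const_mul γ
    convert! ((hc t₀).add h2).add h3 using 1
    field_simp
    ring
  have hed : HasDerivAt e (-(2 * K₁) * e t₀) t₀ := by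
    have h1 : HasDerivAt (fun t => -(2 * K₁) * t) (-(2 * K₁) * 1) t₀ :=
      (hasDerivAt_id t₀).const_mul _
    convert! h1.exp.const_mul k using 1
    simp only [he]; ring
  obtain ⟨D, hD, hDeq⟩ := hasFDerivAt_tube_penalty (p t₀ + b₀) (hp t₀) hgd hed
  have hmem := mem_diniSupergradient_of_hasFDerivAt (Φ := Φ) hD ?_ hDeq
  · have h1 := hΦ.ineq t₀ ht₀0 _ _ hmem
    have h2 := H.hamiltonian_le ht₀0 (p t₀ + b₀)
      ((2 * e t₀) • (p t₀ + b₀ - p t₀)) hv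
    simp only [add_sub_cancel_left, real_inner_smul_left] at h1 h2
    have h3 : inner ℝ b₀ (P.f t₀ (p t₀ + b₀) v) - inner ℝ b₀ (p' t₀) ≤
        K₁ * ‖b₀‖ ^ 2 + κ * ‖b₀‖ := by
      rw [← inner_sub_right]
      have h4 := real_inner_le_norm b₀ (P.f t₀ (p t₀ + b₀) v - p' t₀)
      have h5 : ‖P.f t₀ (p t₀ + b₀) v - p' t₀‖ ≤ K₁ * ‖b₀‖ + κ := by
        have h6 := H.norm_f_sub_le ht₀0 hv (p t₀ + b₀) (p t₀)
        rw [add_sub_cancel_left] at h6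
        rw [norm_sub_rev] at hv1
        calc _ = ‖(P.f t₀ (p t₀ + b₀) v - P.f t₀ (p t₀) v) + (P.f t₀ (p t₀) v - p' t₀)‖ := by
              congr 1; abel
          _ ≤ _ := (norm_add_le _ _).trans (add_le_add h6 hv1)
      nlinarith [norm_nonneg b₀]
    have h7 := (abs_le.1 hv2).2
    have h8 := H.abs_discountedCost_sub_le ht₀0 hv (p t₀ + b₀) (p t₀)
    rw [add_sub_cancel_left] at h8
    have h8 := (abs_le.1 h8).2
    have h9 : 0 < B / (t₀ - s + σ) ^ 2 := by positivity
    have h10 := mul_le_mul_of_nonneg_left h3 (by linarith [hepos t₀] : 0 ≤ 2 * e t₀)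
    have h11 : e t₀ ≤ k := by
      simp only [he]
      refine mul_le_of_le_one_right hk.le (Real.exp_le_one_iff.2 ?_)
      linarith [mul_nonneg hK.le ht₀0]
    have h12 : e t₀ * (κ * ‖b₀‖) ≤ k * κ := by
      have : κ * ‖b₀‖ ≤ κ := mul_le_of_le_one_right hκ hb₀
      exact mul_le_mul h11 this (by positivity) hk.le
    have h13 : K₁ * ‖b₀‖ ≤ K₁ * ρ := by gcongr
    clear_value J g e B Q σ
    linarith
  · have hcont : Continuous fun q : ℝ × EuclideanSpace ℝ (Fin n) => ‖q.2 - p q.1‖ := by fun_prop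
    have hnear : ∀ᶠ q in 𝓝 (t₀, p t₀ + b₀), ‖q.2 - p q.1‖ < 1 :=
      (hcont.tendsto _).eventually_lt_const
        (by simpa using hb₀ρ.trans hρ1)
    have hnear2 : ∀ᶠ q : ℝ × EuclideanSpace ℝ (Fin n) in 𝓝 (t₀, p t₀ + b₀), q.1 ∈ Ioo s T :=
      (continuous_fst.tendsto (t₀, p t₀ + b₀)).eventually (Ioo_mem_nhds hst₀ htT)
    filter_upwards [hnear, hnear2] with q hq1 hq2 _
    have := hmax' q.1 ⟨hq2.1.le, hq2.2.le⟩ (q.2 - p q.1) hq1.le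
    simp only [hJ] at this
    simp only [add_sub_cancel] at this
    simp only [add_sub_cancel_left]
    linarith

/-- Sub-solutions do not decrease faster than the cost accumulates, along any process. -/
theorem subsolution_le_integral_add {Φ : ℝ → EuclideanSpace ℝ (Fin n) → ℝ}
    (hΦ : P.IsDiniSubsolution Φ) {τ : ℝ} (hτ : 0 ≤ τ) {z : EuclideanSpace ℝ (Fin n)}
    {x : ℝ → EuclideanSpace ℝ (Fin n)} {u : ℝ → EuclideanSpace ℝ (Fin m)}
    (h : (x, u) ∈ P.processes τ z) {t₁ T : ℝ} (ht₁ : t₁ ∈ Ioo τ T) :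
    Φ t₁ (x t₁) ≤ Φ T (x T) + ∫ r in t₁..T, P.runningCost x u r := by
  have hK := H.K₁_pos
  have hK2 := H.K₂_pos
  have hτT : τ < T := ht₁.1.trans ht₁.2
  have htr : P.IsTrajectory τ z x u := h.2.1
  have hint : ∀ {a b}, τ ≤ a → τ ≤ b → IntervalIntegrable (P.runningCost x u) volume a b :=
    fun ha hb => H.intervalIntegrable_runningCost hτ htr.continuousOn h.1 ha hb
  -- bounds on the trajectory
  obtain ⟨R, hR⟩ : ∃ R, ∀ r ∈ Icc τ (T + 1), ‖x r‖ ≤ R :=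
    isCompact_Icc.exists_bound_of_continuousOn
      (htr.continuousOn.mono (Icc_subset_Ici_self : Icc τ (T + 1) ⊆ Ici τ))
  have hR0 : 0 ≤ R := (norm_nonneg _).trans (hR τ ⟨le_rfl, by linarith⟩)
  set C := K₁ * R + K₂ with hC
  have hCpos : 0 < C := by positivity
  have hLip : ∀ a b, τ ≤ a → a ≤ b → b ≤ T + 1 → ‖x b - x a‖ ≤ C * (b - a) ∧
      |∫ r in a..b, P.runningCost x u r| ≤ C * (b - a) := fun a b ha hab hb =>
    H.norm_sub_le_of_norm_le hτ h ha hab fun r hr => hR r ⟨ha.trans hr.1, hr.2.trans hb⟩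
  -- continuous extensions of the trajectory and of the accumulated cost
  set X : ℝ → EuclideanSpace ℝ (Fin n) := fun t => x (max τ t) with hX
  have hXc : Continuous X := htr.continuousOn.comp_continuous (by fun_prop) fun t =>
    mem_Ici.2 (le_max_left _ _)
  have hXx : ∀ t, τ ≤ t → X t = x t := fun t ht => by simp [hX, max_eq_right ht]
  set Λ : ℝ → ℝ := fun t => ∫ r in τ..(max τ t), P.runningCost x u r with hΛ
  have hΛx : ∀ t, τ ≤ t → Λ t = ∫ r in τ..t, P.runningCost x u r := fun t ht => by
    simp [hΛ, max_eq_right ht]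
  have hΛsub : ∀ a b, τ ≤ a → τ ≤ b → Λ b - Λ a = ∫ r in a..b, P.runningCost x u r := by
    intro a b ha hb
    rw [hΛx a ha, hΛx b hb,
      intervalIntegral.integral_interval_sub_left (hint le_rfl hb) (hint le_rfl ha)]
  have hΛc : Continuous Λ := by
    rw [continuous_iff_continuousAt]
    intro t
    have h1 : ContinuousOn (fun t => ∫ r in τ..t, P.runningCost x u r)
        (uIcc τ (max τ t + 1)) := intervalIntegral.continuousOn_primitive_interval'
          (hint le_rfl (by linarith [le_max_left τ t])) left_mem_uIcc
    rw [uIcc_of_le (by linarith [le_max_left τ t])] at h1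
    have h2 : ContinuousOn Λ (Iic (max τ t + 1)) :=
      h1.comp (f := fun t => max τ t) (by fun_prop) fun r hr =>
        ⟨le_max_left _ _, max_le (by linarith [le_max_left τ t]) hr⟩
    exact h2.continuousAt (Iic_mem_nhds (by linarith [le_max_right τ t]))
  -- bounds on `Φ`
  set N : Set (ℝ × EuclideanSpace ℝ (Fin n)) := Icc τ T ×ˢ Metric.closedBall 0 (R + 2)
  have hN : IsCompact N := isCompact_Icc.prod (isCompact_closedBall _ _)
  have hΦN : ContinuousOn (fun q : ℝ × EuclideanSpace ℝ (Fin n) => Φ q.1 q.2) N :=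
    hΦ.continuousOn.mono fun q hq => ⟨hτ.trans hq.1.1, mem_univ _⟩
  obtain ⟨M, hM⟩ := hN.exists_bound_of_continuousOn hΦN
  have hM0 : 0 ≤ M := (norm_nonneg _).trans (hM (τ, 0) ⟨⟨le_rfl, hτT.le⟩, by simp; positivity⟩)
  have hunif := hN.uniformContinuousOn_of_continuous hΦN
  rw [Metric.uniformContinuousOn_iff_le] at hunif
  -- The six errors: moving the state in `Φ` at both ends, averaging the accumulated cost at both
  -- ends, the slope `γ`, and the barrier.
  suffices hmain : ∀ θ > 0, Φ t₁ (x t₁) ≤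
      Φ T (x T) + (∫ r in t₁..T, P.runningCost x u r) + 6 * θ by
    refine le_of_forall_pos_le_add fun ε hε => ?_
    have := hmain (ε / 6) (by positivity)
    linarith
  intro θ hθ
  obtain ⟨ρ₁, hρ₁, hunif⟩ := hunif θ hθ
  have hunif' : ∀ t ∈ Icc τ T, ∀ y y' : EuclideanSpace ℝ (Fin n), ‖y‖ ≤ R + 2 → ‖y'‖ ≤ R + 2 →
      ‖y - y'‖ ≤ ρ₁ → |Φ t y - Φ t y'| ≤ θ := by
    intro t ht y y' hy hy' hyy
    refine hunif (t, y) ⟨ht, by simpa using hy⟩ (t, y') ⟨ht, by simpa using hy'⟩ ?_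
    rw [Prod.dist_eq, dist_self, dist_eq_norm]
    exact max_le hρ₁.le hyy
  -- choice of the parameters
  set γ := θ / (T - τ) with hγ
  have hγpos : 0 < γ := div_pos hθ (by linarith)
  set ρ := min (1 / 2) (min (ρ₁ / 2) (γ / (4 * K₁))) with hρ
  have hρpos : 0 < ρ := by positivity
  have hρa : ρ ≤ 1 / 2 := min_le_left _ _
  have hρb : ρ ≤ ρ₁ / 2 := (min_le_right _ _).trans (min_le_left _ _)
  have hρc : K₁ * ρ ≤ γ / 4 := by
    have : ρ ≤ γ / (4 * K₁) := (min_le_right _ _).trans (min_le_right _ _)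
    rw [le_div_iff₀ (by positivity)] at this
    linarith
  -- This makes the penalty at distance `ρ` at least `2 * M + 1` up to time `T`. Then `κ` is chosen
  -- depending on `k`, and the averaging length `d` last.
  set k := (2 * M + 1) * Real.exp (2 * K₁ * T) / ρ ^ 2 with hk
  have hkpos : 0 < k := by positivity
  set κ := γ / (4 * (1 + 2 * k)) with hκ
  have hκpos : 0 < κ := by positivity
  obtain ⟨ρ₂, hρ₂, hmod⟩ := H.exists_modulus (T + 1) (R + 1) hκpos
  obtain ⟨d, hd0, hd1, hdρ₂, hdC⟩ : ∃ d > 0, d ≤ 1 ∧ d ≤ ρ₂ ∧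
      C * d ≤ min (min 1 (ρ₂ / 2)) (min (ρ₁ / 2) θ) := by
    refine ⟨min (min 1 ρ₂) (min (min 1 (ρ₂ / 2)) (min (ρ₁ / 2) θ) / C), by positivity,
      (min_le_left _ _).trans (min_le_left _ _), (min_le_left _ _).trans (min_le_right _ _), ?_⟩
    have := min_le_right (min 1 ρ₂) (min (min 1 (ρ₂ / 2)) (min (ρ₁ / 2) θ) / C)
    rwa [le_div_iff₀ hCpos, mul_comm] at this
  have hdC1 : C * d ≤ 1 := hdC.trans ((min_le_left _ _).trans (min_le_left _ _))
  have hdC2 : C * d ≤ ρ₂ / 2 := hdC.trans ((min_le_left _ _).trans (min_le_right _ _))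
  have hdC3 : C * d ≤ ρ₁ / 2 := hdC.trans ((min_le_right _ _).trans (min_le_left _ _))
  have hdC4 : C * d ≤ θ := hdC.trans ((min_le_right _ _).trans (min_le_right _ _))
  -- Steklov averages
  set p : ℝ → EuclideanSpace ℝ (Fin n) := fun t => d⁻¹ • ∫ r in t..(t + d), X r with hp
  set c : ℝ → ℝ := fun t => -(d⁻¹ • ∫ r in t..(t + d), Λ r) with hc
  have hpX : ∀ t ∈ Icc τ T, ‖p t - x t‖ ≤ C * d := by
    intro t ht
    rw [← hXx t ht.1]
    refine hXc.norm_steklov_sub_le hd0 fun r hr => ?_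
    rw [hXx t ht.1, hXx r (ht.1.trans hr.1)]
    refine (hLip t r ht.1 hr.1 (by linarith [hr.2, ht.2])).1.trans ?_
    exact mul_le_mul_of_nonneg_left (by linarith [hr.2]) hCpos.le
  have hcΛ : ∀ t ∈ Icc τ T, |c t + Λ t| ≤ C * d := by
    intro t ht
    have h1 : ‖(d⁻¹ • ∫ r in t..(t + d), Λ r) - Λ t‖ ≤ C * d := by
      refine hΛc.norm_steklov_sub_le hd0 fun r hr => ?_
      rw [hΛsub t r ht.1 (ht.1.trans hr.1), Real.norm_eq_abs]
      refine (hLip t r ht.1 hr.1 (by linarith [hr.2, ht.2])).2.trans ?_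
      exact mul_le_mul_of_nonneg_left (by linarith [hr.2]) hCpos.le
    rw [← norm_neg, Real.norm_eq_abs] at h1
    convert h1 using 2
    simp only [hc]; ring
  have hxR : ∀ t ∈ Icc τ T, ‖x t‖ ≤ R := fun t ht => hR t ⟨ht.1, by linarith [ht.2]⟩
  have hpR : ∀ t ∈ Icc τ T, ‖p t‖ ≤ R + 1 := by
    intro t ht
    have h1 := norm_sub_norm_le (p t) (x t)
    linarith [hpX t ht, hxR t ht]
  -- The derivatives of the averaged curves are the mean velocity and minus the mean cost over `[t,
  -- t + d]`, which convexity realises by one control value.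
  have happrox : ∀ t ∈ Ioo τ T, ∃ v ∈ P.Ω,
      ‖d⁻¹ • (X (t + d) - X t) - P.f t (p t) v‖ ≤ κ ∧
        |-(d⁻¹ • (Λ (t + d) - Λ t)) + P.discountedCost t (p t) v| ≤ κ := by
    intro t ht
    have ht' : t ∈ Icc τ T := ⟨ht.1.le, ht.2.le⟩
    have ht0 : 0 ≤ t := hτ.trans ht.1.le
    obtain ⟨v, hv, hv1, hv2⟩ := H.exists_control_average hτ h ht.1.le
      (by linarith : t < t + d) ht0 (p t) (κ := κ) (fun r hr v hv => by
        have hr1 : r ≤ T + 1 := by linarith [hr.2, ht.2]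
        have hr2 := hR r ⟨ht.1.le.trans hr.1, hr1⟩
        have h1 := (hLip t r ht.1.le hr.1 hr1).1
        have h2 : C * (r - t) ≤ C * d :=
          mul_le_mul_of_nonneg_left (by linarith [hr.2]) hCpos.le
        have h3 := hpX t ht'
        refine hmod r ⟨ht0.trans hr.1, hr1⟩ t ⟨ht0, by linarith [ht.2]⟩ (x r) (p t)
          (by linarith) (hpR t ht') ?_ ?_ v hv
        · rw [abs_of_nonneg (by linarith [hr.1])]
          linarith [hr.2]
        · rw [norm_sub_rev] at h3
          calc ‖x r - p t‖ = ‖(x r - x t) + (x t - p t)‖ := by congr 1; abel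
            _ ≤ _ := norm_add_le _ _
            _ ≤ ρ₂ := by linarith)
    rw [add_sub_cancel_left] at hv1 hv2
    refine ⟨v, hv, ?_, ?_⟩
    · have : d⁻¹ • (X (t + d) - X t) - P.f t (p t) v =
          d⁻¹ • (x (t + d) - x t - d • P.f t (p t) v) := by
        rw [hXx t ht.1.le, hXx (t + d) (by linarith [ht.1]),
          smul_sub d⁻¹ (x (t + d) - x t), smul_smul, inv_mul_cancel₀ hd0.ne', one_smul]
      rw [this, norm_smul, norm_inv, Real.norm_of_nonneg hd0.le, inv_mul_le_iff₀ hd0]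
      linarith
    · have : -(d⁻¹ • (Λ (t + d) - Λ t)) + P.discountedCost t (p t) v =
          -(d⁻¹ * ((∫ r in t..(t + d), P.runningCost x u r) -
            d * P.discountedCost t (p t) v)) := by
        rw [hΛsub t (t + d) ht.1.le (by linarith [ht.1]), smul_eq_mul]
        field_simp
        ring
      rw [this, abs_neg, abs_mul, abs_of_pos (inv_pos.2 hd0), inv_mul_le_iff₀ hd0]
      linarith
  have hkρ : 2 * M < k * Real.exp (-(2 * K₁) * T) * ρ ^ 2 := by
    have : k * Real.exp (-(2 * K₁) * T) * ρ ^ 2 = 2 * M + 1 := by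
      have h1 : Real.exp (2 * K₁ * T) * Real.exp (-(2 * K₁) * T) = 1 := by
        rw [← Real.exp_add, show 2 * K₁ * T + -(2 * K₁) * T = 0 by ring, Real.exp_zero]
      calc k * Real.exp (-(2 * K₁) * T) * ρ ^ 2
          = (2 * M + 1) * (Real.exp (2 * K₁ * T) * Real.exp (-(2 * K₁) * T)) := by
            rw [hk]; field_simp
        _ = _ := by rw [h1, mul_one]
    linarith
  have hγκ : K₁ * ρ + κ * (1 + 2 * k) < γ := by
    have : κ * (1 + 2 * k) = γ / 4 := by
      rw [hκ]; field_simp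
    linarith
  obtain ⟨b, hb, hle⟩ := H.subsolution_le_along_curve hΦ hτ (p := p) (c := c)
    (p' := fun t => d⁻¹ • (X (t + d) - X t)) (c' := fun t => -(d⁻¹ • (Λ (t + d) - Λ t)))
    (fun t => hXc.hasDerivAt_steklov d t) (fun t => (hΛc.hasDerivAt_steklov d t).neg)
    (M := M) (κ := κ) (k := k) (ρ := ρ) (γ := γ)
    (fun t ht b hb => hM (t, p t + b) ⟨ht, by
      rw [mem_closedBall_zero_iff]
      linarith [norm_add_le (p t) b, hpR t ht]⟩) hκpos.le happrox hkpos hρpos (by linarith) hkρ hγκ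
      ht₁ hθ
  have ht₁' : t₁ ∈ Icc τ T := ⟨ht₁.1.le, ht₁.2.le⟩
  have hT' : T ∈ Icc τ T := ⟨hτT.le, le_rfl⟩
  have h1 := hunif' t₁ ht₁' (p t₁) (x t₁) (by linarith [hpR t₁ ht₁'])
    (by linarith [hxR t₁ ht₁']) (by linarith [hpX t₁ ht₁'])
  have h2 := hunif' T hT' (p T + b) (x T) (by linarith [hpR T hT', norm_add_le (p T) b])
    (by linarith [hxR T hT']) (by
      have : p T + b - x T = (p T - x T) + b := by abel
      rw [this]
      linarith [norm_add_le (p T - x T) b, hpX T hT'])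
  have h3 := hcΛ t₁ ht₁'
  have h4 := hcΛ T hT'
  have h5 := hΛsub t₁ T ht₁.1.le hτT.le
  have h6 : γ * (T - t₁) ≤ θ := by
    rw [hγ, div_mul_eq_mul_div, div_le_iff₀ (by linarith)]
    exact mul_le_mul_of_nonneg_left (by linarith [ht₁.1]) hθ.le
  linarith [(abs_le.1 h1).1, (abs_le.1 h2).2, (abs_le.1 h3).1, (abs_le.1 h3).2,
    (abs_le.1 h4).1, (abs_le.1 h4).2]

omit H in
theorem _root_.HasDecay.tendsto_of_bounded {Φ : ℝ → EuclideanSpace ℝ (Fin n) → ℝ}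
    (hΦ : HasDecay Φ) {S : Set (EuclideanSpace ℝ (Fin n))} (hS : Bornology.IsBounded S) {ε : ℝ}
    (hε : 0 < ε) : ∀ᶠ T in atTop, ∀ y ∈ S, |Φ T y| < ε := by
  have h := hΦ (closure S) hS.isCompact_closure
  rw [Metric.tendstoUniformlyOn_iff] at h
  filter_upwards [h ε hε] with T hT y hy
  simpa [Real.dist_eq] using hT y (subset_closure hy)

/-- The barrier forced an interior starting time; continuity lets that time decrease to `τ`. -/
theorem subsolution_le_integral_add_of_le {Φ : ℝ → EuclideanSpace ℝ (Fin n) → ℝ}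
    (hΦ : P.IsDiniSubsolution Φ) {τ : ℝ} (hτ : 0 ≤ τ) {z : EuclideanSpace ℝ (Fin n)}
    {x : ℝ → EuclideanSpace ℝ (Fin n)} {u : ℝ → EuclideanSpace ℝ (Fin m)}
    (h : (x, u) ∈ P.processes τ z) {T : ℝ} (hT : τ < T) :
    Φ τ z ≤ Φ T (x T) + ∫ r in τ..T, P.runningCost x u r := by
  have htr : P.IsTrajectory τ z x u := h.2.1
  have hint : ∀ {a b}, τ ≤ a → τ ≤ b → IntervalIntegrable (P.runningCost x u) volume a b :=
    fun ha hb => H.intervalIntegrable_runningCost hτ htr.continuousOn h.1 ha hb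
  have h1 : Tendsto (fun t => Φ t (x t)) (𝓝[>] τ) (𝓝 (Φ τ z)) := by
    have h2 : ContinuousOn (fun t => Φ t (x t)) (Ici τ) :=
      hΦ.continuousOn.comp (f := fun t => (t, x t)) (continuousOn_id.prodMk htr.continuousOn)
        fun t ht => ⟨hτ.trans ht, mem_univ _⟩
    have h3 := (h2 τ (mem_Ici.2 le_rfl)).tendsto
    rw [htr.apply_self] at h3
    exact h3.mono_left (nhdsWithin_mono _ Ioi_subset_Ici_self)
  have h4 : Tendsto (fun t => Φ T (x T) + ∫ r in t..T, P.runningCost x u r) (𝓝[>] τ)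
      (𝓝 (Φ T (x T) + ∫ r in τ..T, P.runningCost x u r)) := by
    refine Tendsto.const_add _ ?_
    have h5 : ContinuousOn (fun t => ∫ r in T..t, P.runningCost x u r) (uIcc τ T) :=
      intervalIntegral.continuousOn_primitive_interval' (hint le_rfl hT.le) right_mem_uIcc
    have h6 := (h5 τ left_mem_uIcc).tendsto.neg
    rw [uIcc_of_le hT.le] at h6
    simp only [← intervalIntegral.integral_symm] at h6
    refine h6.mono_left ?_
    rw [← nhdsWithin_Ioc_eq_nhdsGT hT]
    exact nhdsWithin_mono _ Ioc_subset_Icc_self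
  refine le_of_tendsto_of_tendsto h1 h4 ?_
  filter_upwards [Ioo_mem_nhdsGT hT] with t ht
  exact H.subsolution_le_integral_add hΦ hτ h ht

/-- Sub-solutions are below the value function. -/
theorem subsolution_le_value {Φ : ℝ → EuclideanSpace ℝ (Fin n) → ℝ}
    (hΦ : P.IsDiniSubsolution Φ) {τ : ℝ} (hτ : 0 ≤ τ) {z : EuclideanSpace ℝ (Fin n)}
    {S : Set (EuclideanSpace ℝ (Fin n))} (hS : Bornology.IsBounded S)
    (hSb : ∀ p ∈ P.processes τ z, ∀ t, τ ≤ t → p.1 t ∈ S) : Φ τ z ≤ P.value τ z := by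
  refine H.le_value hτ fun x u h => ?_
  have h1 : Tendsto (fun T => ∫ r in τ..T, P.runningCost x u r) atTop (𝓝 (P.cost τ x u)) :=
    intervalIntegral_tendsto_integral_Ioi τ h.2.2 tendsto_id
  have h2 : Tendsto (fun T => Φ T (x T)) atTop (𝓝 0) := by
    rw [Metric.tendsto_nhds]
    intro ε hε
    filter_upwards [hΦ.decay.tendsto_of_bounded hS hε, eventually_ge_atTop τ] with T hT hτT
    simpa [Real.dist_eq] using hT _ (hSb _ h T hτT)
  have h3 := h2.add h1
  rw [zero_add] at h3
  refine ge_of_tendsto h3 ?_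
  filter_upwards [eventually_gt_atTop τ] with T hT
  exact H.subsolution_le_integral_add_of_le hΦ hτ h hT

end Standing

end ControlProblem

/-! ### The descent step for super-solutions -/

/-- A one-sided first-order condition: after division by `r` the quadratic remainder vanishes. It
extracts stationarity of the penalised functional in time and in velocity. -/
theorem nonneg_of_forall_mul_add_sq_nonneg {a b h₀ : ℝ} (hh₀ : 0 < h₀)
    (h : ∀ r ∈ Ioc 0 h₀, 0 ≤ r * a + r ^ 2 * b) : 0 ≤ a := by
  have h1 : Tendsto (fun r : ℝ => a + r * b) (𝓝[>] 0) (𝓝 a) := by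
    have : Continuous fun r : ℝ => a + r * b := by fun_prop
    have h2 := this.tendsto 0
    simp only [zero_mul, add_zero] at h2
    exact h2.mono_left nhdsWithin_le_nhds
  refine ge_of_tendsto h1 ?_
  filter_upwards [Ioc_mem_nhdsGT hh₀] with r hr
  have h2 := h r hr
  have h3 : r * a + r ^ 2 * b = r * (a + r * b) := by ring
  rw [h3] at h2
  exact nonneg_of_mul_nonneg_right h2 hr.1

namespace ControlProblem

variable {n m : ℕ}

/-- The extended velocity set at `(t, x)`, with the velocities fattened by `ε`. -/
def fatVelocities (P : ControlProblem n m) (t : ℝ) (x : EuclideanSpace ℝ (Fin n)) (ε : ℝ) :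
    Set (ℝ × EuclideanSpace ℝ (Fin n)) :=
  {q | ∃ v ∈ P.Ω, q.1 = P.discountedCost t x v ∧ ‖q.2 - P.f t x v‖ ≤ ε}

namespace Standing

variable {P : ControlProblem n m} {K₁ K₂ : ℝ} (H : P.Standing K₁ K₂)
include H

theorem isCompact_fatVelocities {t : ℝ} (ht : 0 ≤ t) (x : EuclideanSpace ℝ (Fin n)) (ε : ℝ) :
    IsCompact (P.fatVelocities t x ε) := by
  have hcf : Continuous fun v => P.f t x v :=
    H.f_cont.comp_continuous (f := fun v => (t, x, v)) (by fun_prop) (fun v => ⟨ht, mem_univ _⟩)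
  have hcL : Continuous fun v => P.discountedCost t x v :=
    H.continuousOn_discountedCost.comp_continuous (f := fun v => (t, x, v)) (by fun_prop)
      (fun v => ⟨ht, mem_univ _⟩)
  have h1 : IsCompact ((fun p : EuclideanSpace ℝ (Fin m) × EuclideanSpace ℝ (Fin n) =>
      (P.discountedCost t x p.1, P.f t x p.1 + p.2)) '' (P.Ω ×ˢ Metric.closedBall 0 ε)) :=
    (H.Ω_compact.prod (isCompact_closedBall _ _)).image (by fun_prop)
  convert h1 using 1
  ext q
  constructor
  · rintro ⟨v, hv, h1, h2⟩
    exact ⟨(v, q.2 - P.f t x v), ⟨hv, by simpa using h2⟩, by ext1 <;> simp [h1]⟩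
  · rintro ⟨⟨v, b⟩, ⟨hv, hb⟩, rfl⟩
    exact ⟨v, hv, rfl, by simpa using hb⟩

/-- The set is the Minkowski sum of the convex extended velocity set and a ball in the velocity
component. -/
theorem convex_fatVelocities {t : ℝ} (ht : 0 ≤ t) (x : EuclideanSpace ℝ (Fin n)) (ε : ℝ) :
    Convex ℝ (P.fatVelocities t x ε) := by
  rintro q ⟨v, hv, h1, h2⟩ q' ⟨v', hv', h1', h2'⟩ a b ha hb hab
  obtain ⟨w, hw, hweq⟩ := H.convex t ht x ⟨v, hv, rfl⟩ ⟨v', hv', rfl⟩ ha hb hab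
  simp only [Prod.smul_mk, Prod.mk_add_mk, Prod.mk.injEq, smul_eq_mul] at hweq
  refine ⟨w, hw, by simp [hweq.1, h1, h1'], ?_⟩
  have h3 : (a • q + b • q').2 - P.f t x w =
      a • (q.2 - P.f t x v) + b • (q'.2 - P.f t x v') := by
    rw [hweq.2, Prod.snd_add, Prod.smul_snd, Prod.smul_snd, smul_sub, smul_sub]
    abel
  rw [h3]
  refine (norm_add_le _ _).trans ?_
  rw [norm_smul, norm_smul, Real.norm_of_nonneg ha, Real.norm_of_nonneg hb]
  calc _ ≤ a * ε + b * ε := by gcongr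
    _ = ε := by rw [← add_mul, hab, one_mul]

/-- From every point, a super-solution decreases, up to a small error, at the rate of the cost
along some short segment with nearly admissible velocity. -/
theorem exists_step_of_isDiniSupersolution {Φ : ℝ → EuclideanSpace ℝ (Fin n) → ℝ}
    (hΦ : P.IsDiniSupersolution Φ) {t : ℝ} (ht : 0 ≤ t) (x : EuclideanSpace ℝ (Fin n))
    {ε : ℝ} (hε : 0 < ε) : ∃ h ∈ Ioo 0 ε, ∃ v ∈ P.Ω, ∃ w, ‖w - P.f t x v‖ ≤ ε ∧
      Φ (t + h) (x + h • w) + h * P.discountedCost t x v ≤ Φ t x + ε * h := by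
  -- Otherwise `Φ` plus cost rises by more than `ε h` along every short segment with fattened
  -- velocity. Such a uniform rise must be witnessed by a sub-gradient nearby.
  by_contra! hneg
  have hK := H.K₁_pos
  have hK2 := H.K₂_pos
  obtain ⟨ρ', hρ', hmod⟩ := H.exists_modulus (t + 1) (‖x‖ + 1) (by positivity : 0 < ε / 4)
  set ρ := min ρ' 1 with hρdef
  have hρ : 0 < ρ := lt_min hρ' one_pos
  have hρ1 : ρ ≤ 1 := min_le_right _ _
  set B := K₁ * ‖x‖ + K₂ with hB
  have hBpos : 0 < B := by positivity
  have hfat : ∀ q ∈ P.fatVelocities t x ε, |q.1| ≤ B ∧ ‖q.2‖ ≤ B + ε := by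
    rintro q ⟨v, hv, h1, h2⟩
    refine ⟨h1 ▸ H.abs_discountedCost_le ht hv x, ?_⟩
    have h3 := norm_sub_norm_le q.2 (P.f t x v)
    linarith [H.norm_f_le ht hv x]
  obtain ⟨r, hr0, hrε, hrρ, hrB⟩ : ∃ r > 0, r < ε ∧ r ≤ ρ / 2 ∧ r * (B + ε) ≤ ρ / 2 := by
    refine ⟨min (ε / 2) (min (ρ / 2) (ρ / 2 / (B + ε))), by positivity,
      (min_le_left _ _).trans_lt (by linarith), (min_le_right _ _).trans (min_le_left _ _), ?_⟩
    rw [← le_div_iff₀ (by positivity)]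
    exact (min_le_right _ _).trans (min_le_right _ _)
  set N : Set (ℝ × EuclideanSpace ℝ (Fin n)) :=
    Icc (max 0 (t - ρ)) (t + ρ) ×ˢ Metric.closedBall x ρ with hNdef
  have hmemN : ∀ s y, 0 ≤ s → |s - t| ≤ ρ → ‖y - x‖ ≤ ρ → (s, y) ∈ N := fun s y hs h1 h2 =>
    ⟨⟨max_le hs (by linarith [(abs_le.1 h1).1]), by linarith [(abs_le.1 h1).2]⟩,
      by rwa [mem_closedBall_iff_norm]⟩
  have hN0 : ∀ q ∈ N, 0 ≤ q.1 := fun q hq => (le_max_left _ _).trans hq.1.1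
  have hN : IsCompact N := isCompact_Icc.prod (isCompact_closedBall _ _)
  have hΦN : ContinuousOn (fun q : ℝ × EuclideanSpace ℝ (Fin n) => Φ q.1 q.2) N :=
    hΦ.continuousOn.mono fun q hq => ⟨hN0 q hq, mem_univ _⟩
  obtain ⟨M, hM⟩ := hN.exists_bound_of_continuousOn hΦN
  have htx : (t, x) ∈ N := hmemN t x ht (by simpa using hρ.le) (by simpa using hρ.le)
  have hM0 : 0 ≤ M := (norm_nonneg _).trans (hM _ htx)
  have hunif := hN.uniformContinuousOn_of_continuous hΦN
  rw [Metric.uniformContinuousOn_iff_le] at hunif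
  obtain ⟨d₁, hd₁, hunif⟩ := hunif (ε * r / 4) (by positivity)
  set d := min d₁ (ρ / 4) with hd
  have hdpos : 0 < d := by positivity
  -- All terms other than the penalty vary by at most `2 * M + r * (B + ε / 2)`, so a minimiser has
  -- penalty distance below `d`.
  set k := (2 * M + r * (B + ε / 2) + 1) / d ^ 2 with hk
  have hkpos : 0 < k := by positivity
  have hkd : k * d ^ 2 = 2 * M + r * (B + ε / 2) + 1 := by
    rw [hk]; field_simp
  -- minimization of the penalized function
  set J : ℝ × (ℝ × EuclideanSpace ℝ (Fin n)) × (ℝ × EuclideanSpace ℝ (Fin n)) → ℝ := fun ω =>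
    Φ ω.2.2.1 ω.2.2.2 + k * ((ω.2.2.1 - t - ω.1) ^ 2 + ‖ω.2.2.2 - x - ω.1 • ω.2.1.2‖ ^ 2)
      + ω.1 * ω.2.1.1 - ε / 2 * ω.1 with hJ
  have hJc : ContinuousOn J (Icc 0 r ×ˢ (P.fatVelocities t x ε ×ˢ N)) := by
    have h1 : ContinuousOn (fun ω : ℝ × (ℝ × EuclideanSpace ℝ (Fin n)) ×
        (ℝ × EuclideanSpace ℝ (Fin n)) => Φ ω.2.2.1 ω.2.2.2)
        (Icc 0 r ×ˢ (P.fatVelocities t x ε ×ˢ N)) :=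
      hΦN.comp (f := fun ω : ℝ × (ℝ × EuclideanSpace ℝ (Fin n)) ×
        (ℝ × EuclideanSpace ℝ (Fin n)) => ω.2.2) (by fun_prop) (fun ω hω => hω.2.2)
    simp only [hJ]
    refine ((h1.add ?_).add ?_).sub ?_ <;> fun_prop
  obtain ⟨v₀, hv₀⟩ := H.Ω_nonempty
  have hq₀ : (P.discountedCost t x v₀, P.f t x v₀) ∈ P.fatVelocities t x ε :=
    ⟨v₀, hv₀, rfl, by simpa using hε.le⟩
  obtain ⟨⟨σ, q, s, y⟩, ⟨hσ, hq, hsy⟩, hmin⟩ :=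
    (isCompact_Icc.prod ((H.isCompact_fatVelocities ht x ε).prod hN)).exists_isMinOn
      ⟨(0, _, (t, x)), ⟨le_rfl, hr0.le⟩, hq₀, htx⟩ hJc
  have hmin' : ∀ σ' ∈ Icc 0 r, ∀ q' ∈ P.fatVelocities t x ε, ∀ p ∈ N,
      J (σ, q, s, y) ≤ J (σ', q', p) := fun σ' hσ' q' hq' p hp => hmin ⟨hσ', hq', hp⟩
  simp only at hσ hq hsy
  clear hmin hJc
  have hs0 : 0 ≤ s := hN0 _ hsy
  obtain ⟨lam, w⟩ := q
  have hqb := hfat _ hq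
  simp only at hqb
  have hJle : J (σ, (lam, w), s, y) ≤ Φ t x := by
    have h1 := hmin' 0 ⟨le_rfl, hr0.le⟩ (lam, w) hq (t, x) htx
    simpa [hJ] using h1
  have hpen : (s - t - σ) ^ 2 + ‖y - x - σ • w‖ ^ 2 < d ^ 2 := by
    have h1 := (abs_le.1 (hM _ hsy)).1
    have h2 := (abs_le.1 (hM _ htx)).2
    simp only [hJ] at hJle
    have h3 : -(r * B) ≤ σ * lam := by
      have h4 : |σ * lam| ≤ r * B := by
        rw [abs_mul, abs_of_nonneg hσ.1]
        exact mul_le_mul hσ.2 hqb.1 (abs_nonneg _) hr0.le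
      exact (abs_le.1 h4).1
    have h5 : ε / 2 * σ ≤ ε / 2 * r := by gcongr; exact hσ.2
    refine lt_of_mul_lt_mul_left ?_ hkpos.le
    simp only at h1 h2
    rw [hkd]
    linarith
  have hA : |s - t - σ| < d := abs_lt_of_sq_lt_sq (by nlinarith [norm_nonneg (y - x - σ • w)])
    hdpos.le
  have hb : ‖y - x - σ • w‖ < d := lt_of_pow_lt_pow_left₀ 2 hdpos.le
    (by nlinarith [sq_nonneg (s - t - σ)])
  have hdρ : d ≤ ρ / 4 := min_le_right _ _
  have hσw : ‖σ • w‖ ≤ ρ / 2 := by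
    rw [norm_smul, Real.norm_of_nonneg hσ.1]
    exact (mul_le_mul hσ.2 hqb.2 (norm_nonneg _) hr0.le).trans hrB
  have hst : |s - t| < ρ := by
    rw [abs_lt] at hA ⊢
    constructor <;> linarith [hσ.1, hσ.2]
  have hyx : ‖y - x‖ < ρ := by
    have h1 := norm_add_le (y - x - σ • w) (σ • w)
    rw [sub_add_cancel] at h1
    linarith
  -- the minimum is not attained at the final time
  have hσr : σ < r := by
    refine lt_of_le_of_ne hσ.2 fun hσr => ?_
    obtain ⟨v, hv, h1, h2⟩ := hq
    simp only at h1 h2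
    -- At `σ = r` the assumed rise `ε r` outweighs the loss `ε r / 4` from moving the point and the
    -- tilt `ε r / 2`, contradicting comparison with `σ = 0`.
    have h3 := hneg r ⟨hr0, hrε⟩ v hv w h2
    have h4 : (t + σ, x + σ • w) ∈ N := hmemN _ _ (by linarith [hσ.1])
      (by rw [add_sub_cancel_left, abs_of_nonneg hσ.1]; linarith [hσ.2])
      (by rw [add_sub_cancel_left]; linarith)
    have h5 := hunif (s, y) hsy _ h4 (by
      rw [Prod.dist_eq, Real.dist_eq, dist_eq_norm]
      refine (max_le ?_ ?_).trans (min_le_left d₁ (ρ / 4))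
      · simp only [← sub_sub]; exact hA.le
      · simp only [← sub_sub]; exact hb.le)
    have h5' := (abs_le.1 h5).1
    simp only [hJ] at hJle
    simp only at h5'
    rw [← h1] at h3
    have h6 : 0 ≤ k * ((s - t - σ) ^ 2 + ‖y - x - σ • w‖ ^ 2) := by positivity
    rw [hσr] at h5' hJle h6
    linarith [mul_pos hε hr0]
  -- the sub-gradient
  set ξ := (2 * (-k)) • (y - (x + σ • w)) with hξ
  set α := -(2 * k * (s - t - σ)) with hα
  have hmem : (α, ξ) ∈ diniSubgradient Φ s y := by
    have hgd : HasDerivAt (fun r => -(k * (r - t - σ) ^ 2)) α s := by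
      have h1 : HasDerivAt (fun r => r - t - σ) 1 s := ((hasDerivAt_id s).sub_const t).sub_const σ
      convert! ((h1.pow 2).const_mul k).neg using 1
      simp [hα]; ring
    -- With the centre held constant and coefficient `-k`, the penalty becomes a paraboloid touching
    -- `Φ` from below at `(s, y)`.
    obtain ⟨D, hD, hDeq⟩ := hasFDerivAt_tube_penalty (p := fun _ => x + σ • w) y
      (hasDerivAt_const s (x + σ • w)) hgd (hasDerivAt_const s (-k))
    refine mem_diniSubgradient_of_hasFDerivAt hD ?_ (fun a v => by rw [hDeq]; simp [hξ])
    have hc1 : Continuous fun p : ℝ × EuclideanSpace ℝ (Fin n) => |p.1 - t| := by fun_prop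
    have hc2 : Continuous fun p : ℝ × EuclideanSpace ℝ (Fin n) => ‖p.2 - x‖ := by fun_prop
    filter_upwards [(hc1.tendsto (s, y)).eventually_lt_const hst,
      (hc2.tendsto (s, y)).eventually_lt_const hyx] with p hp1 hp2 hp0
    have h1 := hmin' σ hσ (lam, w) hq p (hmemN p.1 p.2 hp0 hp1.le hp2.le)
    simp only [hJ] at h1
    simp only [← sub_sub]
    linarith
  -- stationarity in the time parameter
  have hexpand : ∀ (a : ℝ) (e : EuclideanSpace ℝ (Fin n)), ‖y - x - σ • w - a • e‖ ^ 2 =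
      ‖y - x - σ • w‖ ^ 2 - 2 * a * inner ℝ (y - x - σ • w) e + a ^ 2 * ‖e‖ ^ 2 := by
    intro a e
    rw [norm_sub_sq_real, inner_smul_right, norm_smul, mul_pow, Real.norm_eq_abs, sq_abs]
    ring
  have hξw : ∀ e, inner ℝ ξ e = -(2 * k * inner ℝ (y - x - σ • w) e) := by
    intro e
    rw [hξ, real_inner_smul_left, ← sub_sub]
    ring
  -- The hypothesis on `q'` covers `q'` equal to the minimising velocity and, if `σ = 0`, every
  -- `q'`, since then the velocity does not enter the minimum.
  have htime : ∀ q' ∈ P.fatVelocities t x ε, σ • q' = σ • (lam, w) →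
      ε / 2 ≤ α + inner ℝ ξ q'.2 + q'.1 := by
    intro q' hq' hqq
    obtain ⟨lam', w'⟩ := q'
    simp only [Prod.smul_mk, Prod.mk.injEq, smul_eq_mul] at hqq
    rw [hξw]
    suffices 0 ≤ α - 2 * k * inner ℝ (y - x - σ • w) w' + lam' - ε / 2 by
      simp only; linarith
    refine nonneg_of_forall_mul_add_sq_nonneg (b := k * (1 + ‖w'‖ ^ 2))
      (by linarith : 0 < r - σ) fun h hh => ?_
    have h1 := hmin' (σ + h) ⟨by linarith [hσ.1, hh.1], by linarith [hh.2]⟩ (lam', w') hq' (s, y)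
      hsy
    simp only [hJ, add_smul, ← sub_sub, hqq.2, hexpand, add_mul, hqq.1] at h1
    rw [hα]
    linarith
  have hvel : ∀ q' ∈ P.fatVelocities t x ε, ε / 2 ≤ α + inner ℝ ξ q'.2 + q'.1 := by
    intro q' hq'
    rcases eq_or_lt_of_le hσ.1 with hσ0 | hσ0
    · exact htime q' hq' (by rw [← hσ0, zero_smul, zero_smul])
    have h1 := htime _ hq rfl
    obtain ⟨lam', w'⟩ := q'
    simp only at h1 ⊢
    suffices 0 ≤ inner ℝ ξ (w' - w) + (lam' - lam) by
      rw [inner_sub_right] at this; linarith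
    -- Convexity permits moving the velocity towards any `q'`; the resulting variational inequality
    -- carries a factor `σ`, here positive.
    have h2 : 0 ≤ σ * (inner ℝ ξ (w' - w) + (lam' - lam)) := by
      refine nonneg_of_forall_mul_add_sq_nonneg (b := k * σ ^ 2 * ‖w' - w‖ ^ 2) one_pos
        fun h hh => ?_
      have hconv := H.convex_fatVelocities ht x ε hq hq' (by linarith [hh.2] : 0 ≤ 1 - h) hh.1.le
        (by ring)
      have h3 := hmin' σ hσ _ hconv (s, y) hsy
      have h4 : y - x - σ • ((1 - h) • w + h • w') = y - x - σ • w - (σ * h) • (w' - w) := by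
        rw [sub_smul, one_smul, smul_add, smul_sub, smul_smul, smul_smul, smul_sub]
        abel
      simp only [hJ, Prod.smul_mk, Prod.mk_add_mk, h4, hexpand, smul_eq_mul] at h3
      rw [hξw]
      linarith
    exact nonneg_of_mul_nonneg_right h2 hσ0
  -- conclusion
  have hyR : ‖y‖ ≤ ‖x‖ + 1 := by
    have := norm_sub_norm_le y x
    linarith
  -- Here the fattening pays off: velocities at the nearby point `(s, y)` are fat velocities at `(t,
  -- x)`. The change of cost rate uses `ε / 4` of the available `ε / 2`.
  have hham : ε / 4 - α ≤ P.hamiltonian s y ξ := by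
    refine H.le_hamiltonian fun v hv => ?_
    have hst' := (abs_lt.1 hst).2
    have h1 := hmod s ⟨hs0, by linarith⟩ t ⟨ht, by linarith⟩ y x hyR (by linarith)
      (hst.le.trans (min_le_left _ _)) (hyx.le.trans (min_le_left _ _)) v hv
    have h2 := hvel (P.discountedCost t x v, P.f s y v)
      ⟨v, hv, rfl, h1.1.trans (by linarith)⟩
    simp only at h2
    linarith [(abs_le.1 h1.2).1]
  have := hΦ.ineq s hs0 y _ hmem
  simp only at this
  linarith

end Standing

end ControlProblem

/-! ### Continuation near the reachable set and comparison for super-solutions -/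

namespace ControlProblem

variable {n m : ℕ}

/-- `y` lies within `ρ` of states reachable at time `t` from `(τ, z)`, up to arbitrarily small
errors. -/
def NearReachable (P : ControlProblem n m) (τ : ℝ) (z : EuclideanSpace ℝ (Fin n)) (t ρ : ℝ)
    (y : EuclideanSpace ℝ (Fin n)) : Prop :=
  ∀ κ > 0, ∃ x u, (x, u) ∈ P.processes τ z ∧ ‖y - x t‖ ≤ ρ + κ

namespace Standing

variable {P : ControlProblem n m} {K₁ K₂ : ℝ} (H : P.Standing K₁ K₂)
include H

/-- One step of the construction: from `(t, y)` one can move to a later point at which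
`V - Φ` has hardly decreased, staying close to the reachable set. -/
theorem exists_step_value_sub {Φ : ℝ → EuclideanSpace ℝ (Fin n) → ℝ}
    (hΦ : P.IsDiniSupersolution Φ) {τ : ℝ} (hτ : 0 ≤ τ) {z : EuclideanSpace ℝ (Fin n)}
    {t : ℝ} (ht : τ ≤ t) (y : EuclideanSpace ℝ (Fin n)) {ε ρ h₁ : ℝ} (hε : 0 < ε)
    (hh₁ : 0 < h₁) (hy : P.NearReachable τ z t ρ y) :
    ∃ h ∈ Ioc 0 h₁, ∃ y',
      P.value t y - Φ t y ≤
        P.value (t + h) y' - Φ (t + h) y' + (2 + 2 * (K₁ / (P.δ - K₁))) * ε * h ∧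
      P.NearReachable τ z (t + h) (Real.exp (K₁ * h) * ρ + 2 * ε * h) y' := by
  have ht0 : 0 ≤ t := hτ.trans ht
  have hℓ : 0 ≤ K₁ / (P.δ - K₁) := div_nonneg H.K₁_pos.le (by linarith [H.K₁_lt])
  obtain ⟨h₀, hh₀, hexp⟩ := H.exists_const_expansion ht0 y hε
  obtain ⟨h, hh, v, hv, w, hw, hΦw⟩ := H.exists_step_of_isDiniSupersolution hΦ ht0 y
    (lt_min hε (lt_min hh₀ hh₁))
  have hpos : 0 < h := hh.1
  have hε' : min ε (min h₀ h₁) ≤ ε := min_le_left _ _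
  have hle₀ : h ≤ h₀ := hh.2.le.trans ((min_le_right _ _).trans (min_le_left _ _))
  have hle₁ : h ≤ h₁ := hh.2.le.trans ((min_le_right _ _).trans (min_le_right _ _))
  obtain ⟨X, hX⟩ := H.exists_const_mem_processes ht0 y hv
  have hXe := hexp h ⟨hpos, hle₀⟩ v hv X hX
  have hXw : ‖y + h • w - X (t + h)‖ ≤ 2 * ε * h := by
    have h1 : y + h • w - X (t + h) =
        h • (w - P.f t y v) - (X (t + h) - y - h • P.f t y v) := by
      rw [smul_sub]; abel
    rw [h1]
    refine (norm_sub_le _ _).trans ?_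
    rw [norm_smul, Real.norm_of_nonneg hpos.le]
    nlinarith [hXe.1]
  refine ⟨h, ⟨hpos, hle₁⟩, y + h • w, ?_, fun κ hκ => ?_⟩
  -- The loss consists of `ε h` from the step for `Φ`, `ε h` from the cost expansion, and the
  -- Lipschitz constant of `V` times the `2 ε h` by which the segment misses the trajectory.
  · have h1 := H.value_le_integral_add ht0 (by linarith : t ≤ t + h) hX
    have h2 := H.value_sub_le (by linarith : 0 ≤ t + h) (X (t + h)) (y + h • w)
    rw [norm_sub_rev] at h2
    have h3 := mul_le_mul_of_nonneg_left hXw hℓ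
    have h4 := (abs_le.1 hXe.2).2
    have h5 := mul_le_mul_of_nonneg_right hε' hpos.le
    linarith
  -- The reachable state is continued with the same constant control; its distance grows by at most
  -- `e^{K₁ h}`, which the reduced slack compensates.
  · obtain ⟨x, u, hp, hxy⟩ := hy (κ * Real.exp (-(K₁ * h))) (by positivity)
    obtain ⟨x₂, hx₂⟩ := H.exists_const_mem_processes ht0 (x t) hv
    refine ⟨_, _, H.concat hτ ht hp hx₂, ?_⟩
    rw [piecewise_eq_of_notMem _ _ _ (by simpa using hpos)]
    have h1 := H.norm_trajectory_sub_le ht0 hX.1 hX.2.1 hx₂.2.1 (by linarith : t ≤ t + h)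
    rw [add_sub_cancel_left] at h1
    have h2 : ‖y - x t‖ * Real.exp (K₁ * h) ≤ Real.exp (K₁ * h) * ρ + κ := by
      calc _ ≤ (ρ + κ * Real.exp (-(K₁ * h))) * Real.exp (K₁ * h) := by gcongr
        _ = Real.exp (K₁ * h) * ρ + κ * (Real.exp (-(K₁ * h)) * Real.exp (K₁ * h)) := by ring
        _ = _ := by rw [← Real.exp_add, neg_add_cancel, Real.exp_zero, mul_one]
    calc ‖y + h • w - x₂ (t + h)‖
        = ‖(y + h • w - X (t + h)) + (X (t + h) - x₂ (t + h))‖ := by congr 1; abel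
      _ ≤ _ := norm_add_le _ _
      _ ≤ _ := by linarith

/-- Up to any time `T`, the difference `V - Φ` hardly decreases along some points close to the
reachable set. -/
theorem exists_nearReachable_value_sub {Φ : ℝ → EuclideanSpace ℝ (Fin n) → ℝ}
    (hΦ : P.IsDiniSupersolution Φ) {τ : ℝ} (hτ : 0 ≤ τ) {z : EuclideanSpace ℝ (Fin n)}
    {R : ℝ} (hR : ∀ p ∈ P.processes τ z, ∀ t, τ ≤ t → ‖p.1 t‖ ≤ R)
    {T ε : ℝ} (hT : τ ≤ T) (hε : 0 < ε) :
    ∃ y, P.value τ z - Φ τ z ≤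
        P.value T y - Φ T y + (2 + 2 * (K₁ / (P.δ - K₁))) * ε * (T - τ) ∧
      P.NearReachable τ z T (2 * ε * (T - τ) * Real.exp (K₁ * (T - τ))) y := by
  have hK := H.K₁_pos
  have hK2 := H.K₂_pos
  set C := 2 + 2 * (K₁ / (P.δ - K₁)) with hC
  -- This radius dominates the recursion `ρ(t + h) ≥ e^{K₁ h} ρ(t) + 2 ε h` of a single step,
  -- whatever the step lengths.
  set ρ : ℝ → ℝ := fun t => 2 * ε * (t - τ) * Real.exp (K₁ * (t - τ)) with hρ
  have hρc : Continuous ρ := by simp only [hρ]; fun_prop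
  have hρmono : ∀ t ∈ Icc τ T, ρ t ≤ ρ T := by
    intro t ht
    have h1 : Real.exp (K₁ * (t - τ)) ≤ Real.exp (K₁ * (T - τ)) :=
      Real.exp_le_exp.2 (mul_le_mul_of_nonneg_left (by linarith [ht.2]) hK.le)
    have h2 : 0 ≤ t - τ := by linarith [ht.1]
    have h3 : t - τ ≤ T - τ := by linarith [ht.2]
    simp only [hρ]
    gcongr
  -- Step lengths have no positive lower bound, so finite iteration might stall. Instead, the good
  -- times form a closed set that can always be prolonged to the right.
  set A : Set ℝ := {t | ∃ y, P.value τ z - Φ τ z ≤ P.value t y - Φ t y + C * ε * (t - τ) ∧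
    P.NearReachable τ z t (ρ t) y} with hA
  obtain ⟨v₀, hv₀⟩ := H.Ω_nonempty
  have hstart : τ ∈ A := by
    refine ⟨z, by simp, fun κ hκ => ?_⟩
    obtain ⟨x, hx⟩ := H.exists_const_mem_processes hτ z hv₀
    have hxz : x τ = z := hx.2.1.apply_self
    exact ⟨x, _, hx, by simp [hxz, hρ, hκ.le]⟩
  have hR0 : 0 ≤ R := by
    obtain ⟨x, hx⟩ := H.exists_const_mem_processes hτ z hv₀
    exact (norm_nonneg _).trans (hR _ hx τ le_rfl)
  have hclosed : IsClosed (A ∩ Icc τ T) := by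
    refine IsSeqClosed.isClosed fun s t hs hst => ?_
    have htI : t ∈ Icc τ T := isClosed_Icc.mem_of_tendsto hst (Eventually.of_forall fun k => (hs k).2)
    refine ⟨?_, htI⟩
    choose y hy1 hy2 using fun k => (hs k).1
    have hbdd : ∀ k, y k ∈ Metric.closedBall (0 : EuclideanSpace ℝ (Fin n)) (R + ρ T + 1) := by
      intro k
      obtain ⟨x, u, hp, hxy⟩ := hy2 k 1 one_pos
      rw [mem_closedBall_zero_iff]
      have h1 := norm_sub_norm_le (y k) (x (s k))
      have h2 := hR _ hp (s k) (hs k).2.1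
      simp only at h2
      linarith [hρmono (s k) (hs k).2]
    obtain ⟨y₀, -, σ, hσ, hlim⟩ := (isCompact_closedBall _ _).tendsto_subseq hbdd
    have hsσ : Tendsto (fun k => s (σ k)) atTop (𝓝 t) := hst.comp hσ.tendsto_atTop
    have hpair : Tendsto (fun k => (s (σ k), y (σ k))) atTop
        (𝓝[Ici 0 ×ˢ univ] (t, y₀)) :=
      tendsto_nhdsWithin_iff.2 ⟨hsσ.prodMk_nhds hlim, Eventually.of_forall fun k =>
        ⟨hτ.trans (hs (σ k)).2.1, mem_univ _⟩⟩
    have hmem : (t, y₀) ∈ (Ici (0 : ℝ)) ×ˢ (univ : Set (EuclideanSpace ℝ (Fin n))) :=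
      ⟨hτ.trans htI.1, mem_univ _⟩
    refine ⟨y₀, ?_, fun κ hκ => ?_⟩
    · have h1 := (H.continuousOn_value _ hmem).tendsto.comp hpair
      have h2 := (hΦ.continuousOn _ hmem).tendsto.comp hpair
      have h3 := (h1.sub h2).add ((hsσ.sub_const τ).const_mul (C * ε))
      exact ge_of_tendsto h3 (Eventually.of_forall fun k => hy1 (σ k))
    -- The slack in `NearReachable` avoids any limit of trajectories: one sufficiently late index
    -- suffices, with a quarter each for the state, the radius, the old slack and the motion between
    -- the two times.
    · have hκ4 : 0 < κ / 4 := by positivity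
      set M := K₁ * R + K₂ with hM
      have hMpos : 0 < M := by positivity
      have e1 := (tendsto_iff_norm_sub_tendsto_zero.1 hlim).eventually_lt_const hκ4
      have e2 := ((hρc.tendsto t).comp hsσ).eventually_lt_const
        (by linarith : ρ t < ρ t + κ / 4)
      have e3 := (tendsto_iff_norm_sub_tendsto_zero.1 hsσ).eventually_lt_const
        (div_pos hκ4 hMpos)
      obtain ⟨k, hk1, hk2, hk3⟩ := (e1.and (e2.and e3)).exists
      obtain ⟨x, u, hp, hxy⟩ := hy2 (σ k) (κ / 4) hκ4
      refine ⟨x, u, hp, ?_⟩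
      have hlip : ‖x (s (σ k)) - x t‖ ≤ M * ‖s (σ k) - t‖ := by
        rw [Real.norm_eq_abs]
        rcases le_total (s (σ k)) t with hle | hle
        · have h1 := (H.norm_sub_le_of_norm_le hτ hp (R := R) (hs (σ k)).2.1 hle
            (fun r hr => hR _ hp r ((hs (σ k)).2.1.trans hr.1))).1
          rwa [norm_sub_rev, abs_sub_comm, abs_of_nonneg (by linarith)]
        · have h1 := (H.norm_sub_le_of_norm_le hτ hp (R := R) htI.1 hle
            (fun r hr => hR _ hp r (htI.1.trans hr.1))).1
          rwa [abs_of_nonneg (by linarith)]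
      rw [lt_div_iff₀ hMpos, mul_comm] at hk3
      simp only [Function.comp_apply] at hk1 hk2
      rw [norm_sub_rev] at hk1
      calc ‖y₀ - x t‖ = ‖(y₀ - y (σ k)) + (y (σ k) - x (s (σ k))) + (x (s (σ k)) - x t)‖ := by
            congr 1; abel
        _ ≤ _ := norm_add₃_le
        _ ≤ _ := by linarith
  have hstep : ∀ t ∈ A ∩ Ico τ T, ∀ b ∈ Ioi t, (A ∩ Ioc t b).Nonempty := by
    rintro t ⟨⟨y, hy1, hy2⟩, ht⟩ b hb
    obtain ⟨h, hh, y', hy1', hy2'⟩ := H.exists_step_value_sub hΦ hτ ht.1 y hε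
      (sub_pos.2 hb : 0 < b - t) hy2
    refine ⟨t + h, ⟨y', by linarith, fun κ hκ => ?_⟩, by linarith [hh.1], by linarith [hh.2]⟩
    obtain ⟨x, u, hp, hxy⟩ := hy2' κ hκ
    refine ⟨x, u, hp, hxy.trans (add_le_add_left ?_ κ)⟩
    have h1 : Real.exp (K₁ * (t + h - τ)) = Real.exp (K₁ * h) * Real.exp (K₁ * (t - τ)) := by
      rw [← Real.exp_add]; congr 1; ring
    have h2 : 1 ≤ Real.exp (K₁ * (t + h - τ)) :=
      Real.one_le_exp (mul_nonneg hK.le (by linarith [hh.1, ht.1]))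
    have h3 : 2 * ε * h ≤ 2 * ε * h * Real.exp (K₁ * (t + h - τ)) :=
      le_mul_of_one_le_right (by have := hh.1; positivity) h2
    calc Real.exp (K₁ * h) * ρ t + 2 * ε * h
        ≤ Real.exp (K₁ * h) * ρ t + 2 * ε * h * Real.exp (K₁ * (t + h - τ)) := by linarith
      _ = ρ (t + h) := by simp only [hρ, h1]; ring
  exact hclosed.Icc_subset_of_forall_exists_gt hstart hstep ⟨hT, le_rfl⟩

/-- Super-solutions are above the value function. -/
theorem value_le_supersolution {Φ : ℝ → EuclideanSpace ℝ (Fin n) → ℝ}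
    (hΦ : P.IsDiniSupersolution Φ) {τ : ℝ} (hτ : 0 ≤ τ) {z : EuclideanSpace ℝ (Fin n)}
    {S : Set (EuclideanSpace ℝ (Fin n))} (hS : Bornology.IsBounded S)
    (hSb : ∀ p ∈ P.processes τ z, ∀ t, τ ≤ t → p.1 t ∈ S) : P.value τ z ≤ Φ τ z := by
  obtain ⟨R, hR⟩ := hS.exists_norm_le
  have hC : 0 < 2 + 2 * (K₁ / (P.δ - K₁)) := by
    have := div_nonneg H.K₁_pos.le (by linarith [H.K₁_lt] : 0 ≤ P.δ - K₁)
    linarith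
  refine le_of_forall_pos_le_add fun η hη => ?_
  have hball : Bornology.IsBounded (Metric.closedBall (0 : EuclideanSpace ℝ (Fin n)) (R + 2)) :=
    Metric.isBounded_closedBall
  -- The time is fixed before `ε`, which depends on it. The ball must therefore not depend on `ε`:
  -- its extra radius `2` allows `1` for the drift and `1` for the slack.
  obtain ⟨T, hT1, hT2, hT3⟩ := ((hΦ.decay.tendsto_of_bounded hball (by positivity : 0 < η / 3)).and
    ((H.hasDecay_value.tendsto_of_bounded hball (by positivity : 0 < η / 3)).and
      (eventually_gt_atTop τ))).exists
  have hTτ : 0 < T - τ := by linarith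
  set C := 2 + 2 * (K₁ / (P.δ - K₁)) with hCdef
  set D := 2 * (T - τ) * Real.exp (K₁ * (T - τ)) with hD
  have hDpos : 0 < D := by positivity
  obtain ⟨ε, hε, hε1, hε2⟩ : ∃ ε > 0, C * ε * (T - τ) ≤ η / 3 ∧
      2 * ε * (T - τ) * Real.exp (K₁ * (T - τ)) ≤ 1 := by
    refine ⟨min (η / 3 / (C * (T - τ))) (1 / D), by positivity, ?_, ?_⟩
    · have h1 := min_le_left (η / 3 / (C * (T - τ))) (1 / D)
      rw [le_div_iff₀ (by positivity)] at h1
      linarith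
    · have h1 := min_le_right (η / 3 / (C * (T - τ))) (1 / D)
      rw [le_div_iff₀ (by positivity), hD] at h1
      linarith
  obtain ⟨y, hy1, hy2⟩ := H.exists_nearReachable_value_sub hΦ hτ
    (fun p hp t ht => hR _ (hSb p hp t ht)) hT3.le hε
  obtain ⟨x, u, hp, hxy⟩ := hy2 1 one_pos
  have hyR : y ∈ Metric.closedBall (0 : EuclideanSpace ℝ (Fin n)) (R + 2) := by
    rw [mem_closedBall_zero_iff]
    have h1 := norm_sub_norm_le y (x T)
    have h2 := hR _ (hSb _ hp T hT3.le)
    simp only at h2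
    linarith
  linarith [(abs_lt.1 (hT1 y hyR)).1, (abs_lt.1 (hT2 y hyR)).2]

end Standing

end ControlProblem

theorem corollary5p3 {n m : ℕ} (P : ControlProblem n m) (hδ : 0 < P.δ)
    (hΩ_nonempty : P.Ω.Nonempty)
    (K₁ K₂ : ℝ) (hK₁ : 0 < K₁) (hK₂ : 0 < K₂)
    -- Lipschitz continuity in the state
    (h_lip : ∀ t, 0 ≤ t → ∀ u ∈ P.Ω, ∀ x z,
      |P.l t x u - P.l t z u| + ‖P.f t x u - P.f t z u‖ ≤ K₁ * ‖x - z‖)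
    -- linear growth
    (h_growth : ∀ t, 0 ≤ t → ∀ x, ∀ u ∈ P.Ω, |P.l t x u| + ‖P.f t x u‖ ≤ K₂ * (1 + ‖x‖))
    -- continuity of the data on `[0, ∞) × ℝⁿ × ℝᵐ`
    (hl_cont : ContinuousOn
      (fun p : ℝ × EuclideanSpace ℝ (Fin n) × EuclideanSpace ℝ (Fin m) => P.l p.1 p.2.1 p.2.2)
      (Ici 0 ×ˢ univ))
    (hf_cont : ContinuousOn
      (fun p : ℝ × EuclideanSpace ℝ (Fin n) × EuclideanSpace ℝ (Fin m) => P.f p.1 p.2.1 p.2.2)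
      (Ici 0 ×ˢ univ))
    -- convexity of the extended velocity sets
    (h_convex : ∀ t, 0 ≤ t → ∀ x,
      Convex ℝ ((fun v => (Real.exp (-P.δ * t) * P.l t x v, P.f t x v)) '' P.Ω))
    (hΩ_compact : IsCompact P.Ω)
    -- the discount rate dominates, and trajectories are bounded, locally uniformly in the
    -- initial condition
    (hK₁δ : K₁ < P.δ)
    (h_bounded : ∀ τ, 0 ≤ τ → ∀ z : EuclideanSpace ℝ (Fin n),
      ∃ N ∈ 𝓝 (τ, z), ∃ S : Set (EuclideanSpace ℝ (Fin n)), Bornology.IsBounded S ∧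
        ∀ τ' z', (τ', z') ∈ N → 0 ≤ τ' → ∀ p ∈ P.processes τ' z', ∀ t, τ' ≤ t → p.1 t ∈ S) :
    -- the value function is well defined
    (∀ τ, 0 ≤ τ → ∀ z, IsGLB (P.costs τ z) (P.value τ z)) ∧
    -- it is the maximal Dini sub-solution
    (P.IsDiniSubsolution P.value ∧
      ∀ Φ, P.IsDiniSubsolution Φ → ∀ τ, 0 ≤ τ → ∀ z, Φ τ z ≤ P.value τ z) ∧
    -- it is the minimal Dini super-solution
    (P.IsDiniSupersolution P.value ∧
      ∀ Φ, P.IsDiniSupersolution Φ → ∀ τ, 0 ≤ τ → ∀ z, P.value τ z ≤ Φ τ z) ∧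
    -- it is the unique Dini solution
    (P.IsDiniSolution P.value ∧
      ∀ Φ, P.IsDiniSolution Φ → ∀ τ, 0 ≤ τ → ∀ z, Φ τ z = P.value τ z) := by
  have H : P.Standing K₁ K₂ := ⟨hδ, hΩ_nonempty, hK₁, hK₂, h_lip, h_growth, hl_cont, hf_cont,
    h_convex, hΩ_compact, hK₁δ⟩
  have hbdd : ∀ τ, 0 ≤ τ → ∀ z, ∃ S : Set (EuclideanSpace ℝ (Fin n)), Bornology.IsBounded S ∧
      ∀ p ∈ P.processes τ z, ∀ t, τ ≤ t → p.1 t ∈ S := by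
    intro τ hτ z
    obtain ⟨N, hN, S, hS, hSb⟩ := h_bounded τ hτ z
    exact ⟨S, hS, hSb τ z (mem_of_mem_nhds hN) hτ⟩
  have hsub : ∀ Φ, P.IsDiniSubsolution Φ → ∀ τ, 0 ≤ τ → ∀ z, Φ τ z ≤ P.value τ z := by
    intro Φ hΦ τ hτ z
    obtain ⟨S, hS, hSb⟩ := hbdd τ hτ z
    exact H.subsolution_le_value hΦ hτ hS hSb
  have hsuper : ∀ Φ, P.IsDiniSupersolution Φ → ∀ τ, 0 ≤ τ → ∀ z, P.value τ z ≤ Φ τ z := by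
    intro Φ hΦ τ hτ z
    obtain ⟨S, hS, hSb⟩ := hbdd τ hτ z
    exact H.value_le_supersolution hΦ hτ hS hSb
  exact ⟨fun τ hτ z => H.isGLB_value hτ z, ⟨H.isDiniSubsolution_value, hsub⟩,
    ⟨H.isDiniSupersolution_value, hsuper⟩,
    ⟨H.isDiniSubsolution_value, H.isDiniSupersolution_value⟩,
    fun Φ hΦ τ hτ z => le_antisymm (hsub Φ hΦ.1 τ hτ z) (hsuper Φ hΦ.2 τ hτ z)⟩
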